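/- Let $\mathbb{N}=\{1,2,\dots\}$ and $[n]=\{1,\dots,n\}$. A $3$-graph is a finite family $H$ of $3$-element subsets of $\mathbb{N}$ (its edges), and $e(H)$ denotes the number of its edges. The Lagrangian of $H$ is $$\lambda(H)=\max\Big\{\sum_{A\in H}\prod_{i\in A}y_i \;:\; y_1,y_2,\ldots\ge 0 \text{ finitely supported},\ \sum_{i}y_i=1\Big\}.$$ Let $H^{m,3}$ be the $3$-graph whose edges are the first $m$ three-element subsets of $\mathbb{N}$ in the colexicographic order (in which $A<B$ if $A\neq B$ and $\max(A\triangle B)\in B$). There exists a constant $\delta_3>0$ such that for all integers $t\ge 1$ and $m\ge 0$ with $$\binom{t-1}{3}\le m\le \binom{t}{3}-(t-2)-\delta_3t^{3/4}$$ one has $$\lambda(H^{m,3})=\max\{\lambda(H) : H \text{ is a } 3\text{-graph with } e(H)=m\}.$$ -/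

import Mathlib

namespace HypergraphLagrangian

/-- An `r`-graph is a finite family of `r`-element sets of natural numbers; its edges are the
members of the family. -/
def IsUniform (r : ℕ) (H : Finset (Finset ℕ)) : Prop :=
  ∀ A ∈ H, A.card = r

/-- The polynomial `L(H, y)`, the sum over the edges `A` of `H` of the products of `y i`, `i ∈ A`. -/
noncomputable def edgePoly (H : Finset (Finset ℕ)) (y : ℕ →₀ ℝ) : ℝ :=
  ∑ A ∈ H, ∏ i ∈ A, y i

/-- The standard simplex: finitely supported nonnegative weights on the vertices with sum `1`. -/
def weightings : Set (ℕ →₀ ℝ) :=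
  {y | (∀ i, 0 ≤ y i) ∧ ∑ i ∈ y.support, y i = 1}

/-- The Lagrangian `λ(H)`, the largest value of `L(H, y)` on the standard simplex
(the supremum is attained, see `isGreatest_lagrangian`). -/
noncomputable def lagrangian (H : Finset (Finset ℕ)) : ℝ :=
  sSup (edgePoly H '' weightings)

theorem sum_eq_of_mem_weightings {y : ℕ →₀ ℝ} (hy : y ∈ weightings) {s : Finset ℕ}
    (hs : y.support ⊆ s) : ∑ i ∈ s, y i = 1 := by
  rw [← hy.2]
  exact (Finset.sum_subset hs (fun i _ hi => Finsupp.notMem_support_iff.1 hi)).symm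

theorem exists_isGreatest (H : Finset (Finset ℕ)) :
    ∃ l, IsGreatest (edgePoly H '' weightings) l := by
  obtain ⟨n, hn⟩ : ∃ n : ℕ, ∀ A ∈ H, ∀ i ∈ A, i < n + 1 := by
    refine ⟨(H.biUnion id).sup id, fun A hA i hi => Nat.lt_succ_of_le ?_⟩
    exact Finset.le_sup (f := id) (Finset.mem_biUnion.2 ⟨A, hA, hi⟩)
  -- finitely supported functions with support in `{0, …, n}`
  let e : (Fin (n + 1) → ℝ) → (ℕ →₀ ℝ) := fun x =>
    Finsupp.onFinset (Finset.range (n + 1)) (fun i => if h : i < n + 1 then x ⟨i, h⟩ else 0)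
      (fun i hi => by
        by_contra hc
        exact hi (dif_neg (by simpa using hc)))
  have he : ∀ x (i : ℕ), e x i = if h : i < n + 1 then x ⟨i, h⟩ else 0 := fun x i => rfl
  have hsum : ∀ x, ∑ i ∈ (e x).support, e x i = ∑ i, x i := by
    intro x
    rw [Finset.sum_subset (s₂ := Finset.range (n + 1)) Finsupp.support_onFinset_subset
      (fun i _ hi => Finsupp.notMem_support_iff.1 hi), Finset.sum_range]
    exact Finset.sum_congr rfl (fun i _ => by rw [he, dif_pos i.isLt])
  have hcont : Continuous (fun x => edgePoly H (e x)) := by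
    unfold edgePoly
    refine continuous_finsetSum _ (fun A _ => continuous_finsetProd _ (fun i _ => ?_))
    simp only [he]
    split_ifs
    · exact continuous_apply _
    · exact continuous_const
  obtain ⟨x, hx, hmax⟩ := (isCompact_stdSimplex ℝ (Fin (n + 1))).exists_isMaxOn
    ⟨_, single_mem_stdSimplex ℝ (0 : Fin (n + 1))⟩ hcont.continuousOn
  refine ⟨edgePoly H (e x), ⟨e x, ⟨fun i => ?_, by rw [hsum]; exact hx.2⟩, rfl⟩, ?_⟩
  · rw [he]
    split_ifs
    · exact hx.1 _
    · exact le_rfl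
  rintro _ ⟨y, hy, rfl⟩
  -- move the weight outside `{0, …, n}` to the vertex `0`
  let c : ℝ := 1 - ∑ i : Fin (n + 1), y i
  have hc : 0 ≤ c := by
    have h1 := sum_eq_of_mem_weightings hy
      (Finset.subset_union_left (s₁ := y.support) (s₂ := Finset.range (n + 1)))
    have h2 : ∑ i ∈ Finset.range (n + 1), y i ≤ ∑ i ∈ y.support ∪ Finset.range (n + 1), y i :=
      Finset.sum_le_sum_of_subset_of_nonneg Finset.subset_union_right (fun i _ _ => hy.1 i)
    rw [Finset.sum_range] at h2
    simp only [c]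
    linarith
  let z : Fin (n + 1) → ℝ := fun i => y i + if i = 0 then c else 0
  have hz : z ∈ stdSimplex ℝ (Fin (n + 1)) := by
    refine ⟨fun i => add_nonneg (hy.1 _) (by split_ifs <;> simp [hc]), ?_⟩
    simp [z, Finset.sum_add_distrib, c]
  refine le_trans ?_ (hmax hz)
  refine Finset.sum_le_sum (fun A hA => Finset.prod_le_prod (fun i _ => hy.1 i) (fun i hi => ?_))
  rw [he, dif_pos (hn A hA i hi)]
  have : (0 : ℝ) ≤ if (⟨i, hn A hA i hi⟩ : Fin (n + 1)) = 0 then c else 0 := by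
    split_ifs <;> simp [hc]
  simp only [z]
  linarith

theorem isGreatest_lagrangian (H : Finset (Finset ℕ)) :
    IsGreatest (edgePoly H '' weightings) (lagrangian H) := by
  obtain ⟨l, hl⟩ := exists_isGreatest H
  rw [lagrangian, hl.csSup_eq]
  exact hl

/-- The number of `r`-sets inside `{0, …, N - 1}` that precede `A` in the colexicographic order. -/
def colexRank (N r : ℕ) (A : Finset ℕ) : ℕ :=
  {B ∈ (Finset.range N).powersetCard r | toColex B < toColex A}.card

/-- `H^{m,r}`: the first `m` sets of size `r` in the colexicographic order, that is, the `r`-sets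
with fewer than `m` predecessors. For `r ≥ 1` all of them lie in `{0, …, m + r - 1}`, and they form
an initial segment with `m` members (`isInitSeg_colexSegment`, `card_colexSegment`). -/
def colexSegment (m r : ℕ) : Finset (Finset ℕ) :=
  {A ∈ (Finset.range (m + r)).powersetCard r | colexRank (m + r) r A < m}

theorem isInitSeg_colexSegment (m r : ℕ) : Finset.Colex.IsInitSeg (colexSegment m r) r := by
  refine ⟨fun A hA => ?_, fun A B hA hB => ?_⟩
  · exact (Finset.mem_powersetCard.1 (Finset.mem_filter.1 hA).1).2
  · obtain ⟨h1, h2⟩ := Finset.mem_filter.1 hA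
    obtain ⟨h3, -⟩ := Finset.mem_powersetCard.1 h1
    refine Finset.mem_filter.2 ⟨Finset.mem_powersetCard.2 ⟨fun b hb => ?_, hB.2⟩, ?_⟩
    · exact Finset.mem_range.2 (Finset.Colex.forall_lt_mono hB.1.le
        (fun a ha => Finset.mem_range.1 (h3 ha)) b hb)
    · refine lt_of_le_of_lt (Finset.card_le_card fun C hC => ?_) h2
      rw [Finset.mem_filter] at hC ⊢
      exact ⟨hC.1, hC.2.trans hB.1⟩

theorem card_colexSegment (m r : ℕ) (hr : 1 ≤ r) : (colexSegment m r).card = m := by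
  set S := (Finset.range (m + r)).powersetCard r with hS
  have hcard : m ≤ S.card := by
    rw [hS, Finset.card_powersetCard, Finset.card_range]
    obtain ⟨k, rfl⟩ := Nat.exists_eq_add_of_le hr
    induction m with
    | zero => simp
    | succ m ih =>
      have h1 : m + 1 + (1 + k) = (m + (1 + k)) + 1 := by ring
      have h2 : 0 < (m + (1 + k)).choose k := Nat.choose_pos (by omega)
      have h3 := Nat.choose_succ_succ' (m + (1 + k)) k
      have h4 : m ≤ (m + (1 + k)).choose (1 + k) := ih rfl
      rw [h1]
      rw [add_comm 1 k] at *
      omega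
  have hlt : ∀ A ∈ S, ∀ B, toColex A < toColex B →
      colexRank (m + r) r A < colexRank (m + r) r B := by
    intro A hA B hAB
    refine Finset.card_lt_card ⟨fun C hC => ?_, fun h => ?_⟩
    · rw [Finset.mem_filter] at hC ⊢
      exact ⟨hC.1, hC.2.trans hAB⟩
    · have := (Finset.mem_filter.1 (h (Finset.mem_filter.2 ⟨hA, hAB⟩))).2
      exact lt_irrefl _ this
  have hinj : Set.InjOn (colexRank (m + r) r) S := by
    intro A hA B hB h
    rcases lt_trichotomy (toColex A) (toColex B) with h1 | h1 | h1
    · exact absurd h (hlt A hA B h1).ne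
    · exact toColex_inj.1 h1
    · exact absurd h (hlt B hB A h1).ne'
  have himg : S.image (colexRank (m + r) r) = Finset.range S.card := by
    refine Finset.eq_of_subset_of_card_le (fun k hk => ?_) ?_
    · obtain ⟨A, hA, rfl⟩ := Finset.mem_image.1 hk
      refine Finset.mem_range.2 (Finset.card_lt_card ⟨Finset.filter_subset _ _, fun h => ?_⟩)
      exact lt_irrefl _ (Finset.mem_filter.1 (h hA)).2
    · rw [Finset.card_image_of_injOn hinj, Finset.card_range]
  have h5 : (colexSegment m r).image (colexRank (m + r) r) = Finset.range m := by
    ext k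
    simp only [colexSegment, Finset.mem_image, Finset.mem_filter, Finset.mem_range]
    constructor
    · rintro ⟨A, ⟨-, h⟩, rfl⟩
      exact h
    · intro hk
      have : k ∈ S.image (colexRank (m + r) r) := by
        rw [himg]
        exact Finset.mem_range.2 (hk.trans_le hcard)
      obtain ⟨A, hA, rfl⟩ := Finset.mem_image.1 this
      exact ⟨A, ⟨hA, hk⟩, rfl⟩
  have hsub : Set.InjOn (colexRank (m + r) r) (colexSegment m r) :=
    hinj.mono (fun A hA => (Finset.mem_filter.1 hA).1)
  rw [← Finset.card_image_of_injOn hsub, h5, Finset.card_range]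

end HypergraphLagrangian

namespace HypergraphLagrangian

/-! Put n = t - 1. The colex segment contains every triple of the first n vertices, so its
Lagrangian is at least that of the complete 3-graph on n vertices (`le_lagrangian_colexSegment`). It
remains to see that no 3-graph with m edges exceeds this value (`isBound_of_le`); an error term of
order √n suffices, which is below t^(3/4).

Take a counterexample H, y on a smallest vertex set S. Optimality and minimality make all weights
positive, all links equal and every pair of vertices covered by an edge; after a tie-break, the
heaviest vertex p lies in no missing triple (`exists_isExtremal`). Since the link of p is then
complete, the value of H and the link of each vertex among the missing triples become explicit
functions of y.

If |S| ≤ n, the complete 3-graph already gives the bound. If |S| ≥ n + 2, the weight of the lightest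
vertex q moves to p at a cost of at most y_q², and the edge budget freed at q buys missing triples
of total weight at least y_q², so S was not minimal (`IsExtremal.false_of_large`).

If |S| = n + 1, write y_i = y_p(1 - d_i) and ε = 1 - d_q, with q lightest. Summing the link
equations against 1 - d_i and against d_i bounds the number of missing triples by n + O(1/ε); when ε
≤ 1/√n, a Cauchy–Schwarz estimate gives n + O(√n) instead (`IsDefect.card_le`). The hypothesis on m
demands more missing triples than that. -/

open Finset

/-! ### Trilinear forms and links of 3-graphs -/

/-- The polynomial `L(G, y)` for an arbitrary weight function `y`. -/
noncomputable def weight (G : Finset (Finset ℕ)) (y : ℕ → ℝ) : ℝ :=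
  ∑ A ∈ G, ∏ i ∈ A, y i

/-- The indicator of `{i, j, l} ∈ G`. -/
noncomputable def ind (G : Finset (Finset ℕ)) (i j l : ℕ) : ℝ :=
  if ({i, j, l} : Finset ℕ) ∈ G then 1 else 0

/-- The symmetric trilinear form of the `3`-graph `G` on the vertex set `S`. -/
noncomputable def form (S : Finset ℕ) (G : Finset (Finset ℕ)) (u v w : ℕ → ℝ) : ℝ :=
  ∑ i ∈ S, ∑ j ∈ S, ∑ l ∈ S, ind G i j l * u i * v j * w l

/-- Twice the weight of the link of `i` in `G`. -/
noncomputable def link (S : Finset ℕ) (G : Finset (Finset ℕ)) (y : ℕ → ℝ) (i : ℕ) : ℝ :=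
  ∑ j ∈ S, ∑ l ∈ S, ind G i j l * y j * y l

theorem ind_nonneg (G : Finset (Finset ℕ)) (i j l : ℕ) : 0 ≤ ind G i j l := by
  unfold ind; split_ifs <;> norm_num

theorem ind_le_one (G : Finset (Finset ℕ)) (i j l : ℕ) : ind G i j l ≤ 1 := by
  unfold ind; split_ifs <;> norm_num

theorem ind_swap (G : Finset (Finset ℕ)) (i j l : ℕ) : ind G i j l = ind G j i l := by
  unfold ind; rw [Finset.insert_comm]

theorem ind_swap' (G : Finset (Finset ℕ)) (i j l : ℕ) : ind G i j l = ind G i l j := by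
  unfold ind; rw [Finset.pair_comm]

theorem card_triple {i j l : ℕ} : ({i, j, l} : Finset ℕ).card = 3 ↔ i ≠ j ∧ i ≠ l ∧ j ≠ l := by
  constructor
  · intro h
    refine ⟨?_, ?_, ?_⟩ <;> rintro rfl
    · rw [Finset.insert_eq_of_mem (by simp)] at h
      have := Finset.card_le_two (a := i) (b := l); omega
    · rw [Finset.insert_eq_of_mem (by simp)] at h
      have := Finset.card_le_two (a := j) (b := i); omega
    · simp only [Finset.mem_singleton, Finset.insert_eq_of_mem] at h
      have := Finset.card_le_two (a := i) (b := j); omega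
  · rintro ⟨h1, h2, h3⟩
    exact Finset.card_eq_three.2 ⟨i, j, l, h1, h2, h3, rfl⟩

variable {S : Finset ℕ} {G : Finset (Finset ℕ)}

theorem ne_of_mem (hG : G ⊆ S.powersetCard 3) {i j l : ℕ} (h : ({i, j, l} : Finset ℕ) ∈ G) :
    i ≠ j ∧ i ≠ l ∧ j ≠ l :=
  card_triple.1 (mem_powersetCard.1 (hG h)).2

theorem ind_self (hG : G ⊆ S.powersetCard 3) (i l : ℕ) : ind G i i l = 0 :=
  if_neg fun h => (ne_of_mem hG h).1 rfl

theorem sum_triple (y : ℕ → ℝ) {A : Finset ℕ} (hA : A ∈ S.powersetCard 3) :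
    ∑ i ∈ S, ∑ j ∈ S, ∑ l ∈ S, (if ({i, j, l} : Finset ℕ) = A then y i * y j * y l else 0)
      = 6 * ∏ i ∈ A, y i := by
  obtain ⟨hAS, hc⟩ := mem_powersetCard.1 hA
  have e1 : ∑ i ∈ S, ∑ j ∈ S, ∑ l ∈ S,
        (if ({i, j, l} : Finset ℕ) = A then y i * y j * y l else 0)
      = ∑ i ∈ A, ∑ j ∈ A, ∑ l ∈ A,
        (if i ≠ j ∧ i ≠ l ∧ j ≠ l then y i * y j * y l else 0) := by
    refine (Finset.sum_subset hAS fun i _ hi => ?_).symm.trans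
      (Finset.sum_congr rfl fun i hi => ?_)
    · refine Finset.sum_eq_zero fun j _ => Finset.sum_eq_zero fun l _ => if_neg ?_
      rintro rfl; simp at hi
    refine (Finset.sum_subset hAS fun j _ hj => ?_).symm.trans
      (Finset.sum_congr rfl fun j hj => ?_)
    · refine Finset.sum_eq_zero fun l _ => if_neg ?_
      rintro rfl; simp at hj
    refine (Finset.sum_subset hAS fun l _ hl => ?_).symm.trans
      (Finset.sum_congr rfl fun l hl => ?_)
    · refine if_neg ?_
      rintro rfl; simp at hl
    refine if_congr ?_ rfl rfl
    rw [← card_triple]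
    constructor
    · rintro rfl; exact hc
    · intro h
      refine Finset.eq_of_subset_of_card_le ?_ (by omega)
      simp [Finset.insert_subset_iff, hi, hj, hl]
  rw [e1]
  obtain ⟨a, b, c, hab, hac, hbc, rfl⟩ := Finset.card_eq_three.1 hc
  simp [Finset.sum_insert, Finset.prod_insert, hab, hac, hbc, hab.symm, hac.symm, hbc.symm]
  ring

theorem form_self (hG : G ⊆ S.powersetCard 3) (y : ℕ → ℝ) :
    form S G y y y = 6 * weight G y := by
  have : ∀ i j l, ind G i j l * y i * y j * y l
      = ∑ A ∈ G, if ({i, j, l} : Finset ℕ) = A then y i * y j * y l else 0 := by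
    intro i j l
    rw [Finset.sum_ite_eq]
    unfold ind
    split_ifs <;> ring
  unfold form weight
  simp_rw [this]
  rw [Finset.mul_sum, ← Finset.sum_congr rfl fun A hA => sum_triple y (hG hA)]
  rw [Finset.sum_comm]
  conv_rhs => rw [Finset.sum_comm]
  rw [Finset.sum_comm]
  refine Finset.sum_congr rfl fun i _ => ?_
  rw [Finset.sum_comm]
  conv_rhs => rw [Finset.sum_comm]
  rw [Finset.sum_comm]
  refine Finset.sum_congr rfl fun j _ => ?_
  rw [Finset.sum_comm]

theorem form_eq_sum_link (y : ℕ → ℝ) : form S G y y y = ∑ i ∈ S, y i * link S G y i := by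
  unfold form link
  refine Finset.sum_congr rfl fun i _ => ?_
  rw [Finset.mul_sum]
  refine Finset.sum_congr rfl fun j _ => ?_
  rw [Finset.mul_sum]
  exact Finset.sum_congr rfl fun l _ => by ring

theorem form_swap (u v w : ℕ → ℝ) : form S G u v w = form S G v u w := by
  unfold form
  rw [Finset.sum_comm]
  refine Finset.sum_congr rfl fun i _ => Finset.sum_congr rfl fun j _ =>
    Finset.sum_congr rfl fun l _ => ?_
  rw [ind_swap]; ring

theorem form_swap' (u v w : ℕ → ℝ) : form S G u v w = form S G u w v := by
  unfold form
  refine Finset.sum_congr rfl fun i _ => ?_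
  rw [Finset.sum_comm]
  refine Finset.sum_congr rfl fun j _ => Finset.sum_congr rfl fun l _ => ?_
  rw [ind_swap']; ring

theorem form_add_smul (s : ℝ) (u v w z : ℕ → ℝ) :
    form S G (fun i => u i + s * v i) w z = form S G u w z + s * form S G v w z := by
  unfold form
  simp only [Finset.mul_sum, ← Finset.sum_add_distrib]
  refine Finset.sum_congr rfl fun i _ => Finset.sum_congr rfl fun j _ =>
    Finset.sum_congr rfl fun l _ => by ring

theorem form_add_smul_self (s : ℝ) (y v : ℕ → ℝ) :
    form S G (fun i => y i + s * v i) (fun i => y i + s * v i) (fun i => y i + s * v i)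
      = form S G y y y + 3 * s * form S G v y y + 3 * s ^ 2 * form S G v v y
        + s ^ 3 * form S G v v v := by
  have e1 : ∀ u w, form S G u (fun i => y i + s * v i) w
      = form S G u y w + s * form S G u v w := fun u w => by
    rw [form_swap, form_add_smul, form_swap y, form_swap v]
  have e2 : ∀ u w, form S G u w (fun i => y i + s * v i)
      = form S G u w y + s * form S G u w v := fun u w => by
    rw [form_swap', e1, form_swap' u y, form_swap' u v]
  rw [form_add_smul, e1, e1, e2, e2, e2, e2, form_swap y v y, form_swap' y y v, form_swap y v y,
    form_swap y v v, form_swap' v y v]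
  ring

theorem form_single (y : ℕ → ℝ) {r : ℕ} (hr : r ∈ S) :
    form S G (Pi.single r 1) y y = link S G y r := by
  unfold form link
  rw [Finset.sum_eq_single_of_mem r hr]
  · simp
  · intro i _ hi
    simp [Pi.single_eq_of_ne hi]

theorem form_single_single (y : ℕ → ℝ) {r q : ℕ} (hr : r ∈ S) (hq : q ∈ S) :
    form S G (Pi.single r 1) (Pi.single q 1) y = ∑ l ∈ S, ind G r q l * y l := by
  unfold form
  rw [Finset.sum_eq_single_of_mem r hr, Finset.sum_eq_single_of_mem q hq]
  · simp
  · intro i _ hi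
    simp [Pi.single_eq_of_ne hi]
  · intro i _ hi
    simp [Pi.single_eq_of_ne hi]

/-- Moving the weight `s` from the vertex `q` to the vertex `r`. -/
theorem weight_move (hG : G ⊆ S.powersetCard 3) (y : ℕ → ℝ) (s : ℝ) {r q : ℕ}
    (hr : r ∈ S) (hq : q ∈ S) :
    weight G (fun i => y i + s * ((Pi.single r 1 : ℕ → ℝ) i + (-1) * (Pi.single q 1 : ℕ → ℝ) i))
      = weight G y + s / 2 * (link S G y r - link S G y q)
        - s ^ 2 * ∑ l ∈ S, ind G r q l * y l := by
  -- Expand in the direction e_r - e_q. No edge uses a vertex twice, so the cubic term vanishes and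
  -- only the mixed part of the quadratic term survives.
  have h := form_add_smul_self (S := S) (G := G) s y
    (fun i => (Pi.single r 1 : ℕ → ℝ) i + (-1) * (Pi.single q 1 : ℕ → ℝ) i)
  have z1 : ∀ w {a : ℕ}, a ∈ S → form S G (Pi.single a 1) (Pi.single a 1) w = 0 := by
    intro w a ha
    rw [form_single_single w ha ha]
    exact Finset.sum_eq_zero fun l _ => by rw [ind_self hG, zero_mul]
  have e1 : ∀ w, form S G (fun i => (Pi.single r 1 : ℕ → ℝ) i + (-1) * (Pi.single q 1 : ℕ → ℝ) i)
      (fun i => (Pi.single r 1 : ℕ → ℝ) i + (-1) * (Pi.single q 1 : ℕ → ℝ) i) w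
      = -2 * form S G (Pi.single r 1) (Pi.single q 1) w := by
    intro w
    rw [form_add_smul, form_swap (Pi.single r 1), form_swap (Pi.single q 1), form_add_smul,
      form_add_smul, z1 w hr, z1 w hq, form_swap (Pi.single q 1) (Pi.single r 1)]
    ring
  rw [e1, e1, form_self hG, form_self hG, form_add_smul, form_single y hr, form_single y hq,
    form_single_single y hr hq] at h
  have e2 : form S G (Pi.single r 1) (Pi.single q 1)
      (fun i => (Pi.single r 1 : ℕ → ℝ) i + (-1) * (Pi.single q 1 : ℕ → ℝ) i) = 0 := by
    rw [form_swap', form_swap, form_add_smul, z1 _ hr, form_swap', z1 _ hq]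
    ring
  rw [e2] at h
  linarith

theorem weight_filter_mem (hG : G ⊆ S.powersetCard 3) (y : ℕ → ℝ) {r : ℕ} (hr : r ∈ S) :
    2 * weight (G.filter (r ∈ ·)) y = y r * link S G y r := by
  have h1 := form_self (S := S) ((filter_subset (r ∈ ·) G).trans hG) y
  -- An ordered edge through r has r in exactly one of its three slots. The summand `0 +` gives the
  -- shape that `form_add_smul` expects.
  have h2 : form S (G.filter (r ∈ ·)) y y y
      = form S G (fun i => 0 + y r * (Pi.single r 1 : ℕ → ℝ) i) y y
        + form S G y (fun i => 0 + y r * (Pi.single r 1 : ℕ → ℝ) i) y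
        + form S G y y (fun i => 0 + y r * (Pi.single r 1 : ℕ → ℝ) i) := by
    unfold form
    simp only [← Finset.sum_add_distrib]
    refine Finset.sum_congr rfl fun i _ => Finset.sum_congr rfl fun j _ =>
      Finset.sum_congr rfl fun l _ => ?_
    by_cases h : ({i, j, l} : Finset ℕ) ∈ G
    · obtain ⟨a, b, c⟩ := ne_of_mem hG h
      by_cases hi : r = i
      · subst hi; simp [ind, h, a.symm, b.symm]
      by_cases hj : r = j
      · subst hj; simp [ind, h, a, c.symm]
      by_cases hl : r = l
      · subst hl; simp [ind, h, b, c]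
      simp [ind, h, hi, hj, hl, Ne.symm hi, Ne.symm hj, Ne.symm hl]
    · simp [ind, h]
  rw [form_swap' y y (fun i => 0 + y r * (Pi.single r 1 : ℕ → ℝ) i),
    form_swap y (fun i => 0 + y r * (Pi.single r 1 : ℕ → ℝ) i)] at h2
  have h3 : form S G (fun i => 0 + y r * (Pi.single r 1 : ℕ → ℝ) i) y y = y r * link S G y r := by
    rw [form_add_smul, form_single y hr]
    simp [form]
  rw [h3, h1] at h2
  linarith

theorem ind_complete {i j l : ℕ} (hi : i ∈ S) (hj : j ∈ S) (hl : l ∈ S) :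
    ind (S.powersetCard 3) i j l = if i ≠ j ∧ i ≠ l ∧ j ≠ l then 1 else 0 := by
  unfold ind
  refine if_congr ?_ rfl rfl
  rw [mem_powersetCard, card_triple]
  simp [Finset.insert_subset_iff, hi, hj, hl]

theorem link_complete (y : ℕ → ℝ) {i : ℕ} (hi : i ∈ S) :
    link S (S.powersetCard 3) y i
      = (∑ j ∈ S, y j - y i) ^ 2 - (∑ j ∈ S, y j ^ 2 - y i ^ 2) := by
  have h1 : ∑ j ∈ S.erase i, y j = ∑ j ∈ S, y j - y i := by
    rw [← Finset.add_sum_erase S y hi]; ring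
  have h2 : ∑ j ∈ S.erase i, y j ^ 2 = ∑ j ∈ S, y j ^ 2 - y i ^ 2 := by
    rw [← Finset.add_sum_erase S (fun j => y j ^ 2) hi]; ring
  rw [← h1, ← h2]
  have h3 : link S (S.powersetCard 3) y i
      = ∑ j ∈ S.erase i, ∑ l ∈ S.erase i, (y j * y l - if l = j then y j * y l else 0) := by
    unfold link
    refine (Finset.sum_subset (Finset.erase_subset i S) fun j hj hj' => ?_).symm.trans
      (Finset.sum_congr rfl fun j hj => ?_)
    · have : i = j := by by_contra h; exact hj' (mem_erase.2 ⟨Ne.symm h, hj⟩)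
      subst this
      refine Finset.sum_eq_zero fun l hl => ?_
      rw [ind_complete hi hi hl]; simp
    obtain ⟨hji, hj⟩ := mem_erase.1 hj
    refine (Finset.sum_subset (Finset.erase_subset i S) fun l hl hl' => ?_).symm.trans
      (Finset.sum_congr rfl fun l hl => ?_)
    · have : i = l := by by_contra h; exact hl' (mem_erase.2 ⟨Ne.symm h, hl⟩)
      subst this
      rw [ind_complete hi hj hi]; simp
    obtain ⟨hli, hl⟩ := mem_erase.1 hl
    rw [ind_complete hi hj hl]
    by_cases h : l = j
    · subst h; simp
    · simp [h, Ne.symm h, hli.symm, hji.symm]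
  rw [h3]
  simp only [Finset.sum_sub_distrib]
  congr 1
  · rw [sq, Finset.sum_mul_sum]
  · refine Finset.sum_congr rfl fun j hj => ?_
    rw [Finset.sum_ite_eq_of_mem' _ _ _ hj]; ring

theorem weight_complete (y : ℕ → ℝ) :
    6 * weight (S.powersetCard 3) y
      = (∑ i ∈ S, y i) ^ 3 - 3 * (∑ i ∈ S, y i) * (∑ i ∈ S, y i ^ 2) + 2 * ∑ i ∈ S, y i ^ 3 := by
  rw [← form_self subset_rfl, form_eq_sum_link,
    Finset.sum_congr rfl fun i hi => by rw [link_complete y hi]]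
  set Y := ∑ i ∈ S, y i
  set P := ∑ i ∈ S, y i ^ 2
  have : ∀ i, y i * ((Y - y i) ^ 2 - (P - y i ^ 2))
      = (Y ^ 2 - P) * y i - 2 * Y * y i ^ 2 + 2 * y i ^ 3 := fun i => by ring
  simp_rw [this]
  rw [Finset.sum_add_distrib, Finset.sum_sub_distrib, ← Finset.mul_sum, ← Finset.mul_sum,
    ← Finset.mul_sum]
  change (Y ^ 2 - P) * Y - 2 * Y * P + _ = _
  ring

theorem link_sdiff (hG : G ⊆ S.powersetCard 3) (y : ℕ → ℝ) (i : ℕ) :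
    link S (S.powersetCard 3 \ G) y i = link S (S.powersetCard 3) y i - link S G y i := by
  unfold link
  simp only [← Finset.sum_sub_distrib]
  refine Finset.sum_congr rfl fun j _ => Finset.sum_congr rfl fun l _ => ?_
  have : ind (S.powersetCard 3 \ G) i j l
      = ind (S.powersetCard 3) i j l - ind G i j l := by
    unfold ind
    by_cases h : ({i, j, l} : Finset ℕ) ∈ G
    · have h2 := hG h
      simp [h, h2]
    · by_cases h2 : ({i, j, l} : Finset ℕ) ∈ S.powersetCard 3 <;>
        simp only [Finset.mem_sdiff, h, h2] <;> simp
  rw [this]; ring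

theorem weight_one (G : Finset (Finset ℕ)) : weight G (fun _ => 1) = G.card := by
  simp [weight]

theorem weight_mono {G' : Finset (Finset ℕ)} (h : G ⊆ G') (hG' : G' ⊆ S.powersetCard 3)
    {y : ℕ → ℝ} (hy : ∀ i ∈ S, 0 ≤ y i) : weight G y ≤ weight G' y :=
  Finset.sum_le_sum_of_subset_of_nonneg h fun _ hA _ =>
    Finset.prod_nonneg fun i hi => hy i ((mem_powersetCard.1 (hG' hA)).1 hi)


/-! ### Optimal pairs and the structure of a minimal counterexample -/

/-- `c` bounds the Lagrangians of all `3`-graphs on `S` with at most `m` edges. -/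
def IsBound (S : Finset ℕ) (m : ℕ) (c : ℝ) : Prop :=
  ∀ H ⊆ S.powersetCard 3, H.card ≤ m → ∀ y : ℕ → ℝ, (∀ i ∈ S, 0 ≤ y i) →
    ∑ i ∈ S, y i = 1 → weight H y ≤ c

/-- `H` and `y` maximise the weight among the `3`-graphs on `S` with at most `m` edges. -/
structure IsOptimum (S : Finset ℕ) (m : ℕ) (H : Finset (Finset ℕ)) (y : ℕ → ℝ) : Prop where
  sub : H ⊆ S.powersetCard 3
  card_le : H.card ≤ m
  nonneg : ∀ i ∈ S, 0 ≤ y i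
  sum_eq : ∑ i ∈ S, y i = 1
  max : IsBound S m (weight H y)

theorem weight_congr {S : Finset ℕ} {G : Finset (Finset ℕ)} (hG : G ⊆ S.powersetCard 3)
    {y z : ℕ → ℝ} (h : ∀ i ∈ S, y i = z i) : weight G y = weight G z :=
  Finset.sum_congr rfl fun _ hA => Finset.prod_congr rfl fun i hi =>
    h i ((mem_powersetCard.1 (hG hA)).1 hi)

theorem exists_max_weight {S : Finset ℕ} (hS : S.Nonempty) {G : Finset (Finset ℕ)}
    (hG : G ⊆ S.powersetCard 3) :
    ∃ y : ℕ → ℝ, (∀ i ∈ S, 0 ≤ y i) ∧ ∑ i ∈ S, y i = 1 ∧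
      ∀ z : ℕ → ℝ, (∀ i ∈ S, 0 ≤ z i) → ∑ i ∈ S, z i = 1 → weight G z ≤ weight G y := by
  classical
  let K : Set (ℕ → ℝ) := Set.pi Set.univ (fun i => if i ∈ S then Set.Icc (0 : ℝ) 1 else {0}) ∩
    {y | ∑ i ∈ S, y i = 1}
  have hK : IsCompact K := by
    refine IsCompact.inter_right (isCompact_univ_pi fun i => ?_) ?_
    · split_ifs
      · exact isCompact_Icc
      · exact isCompact_singleton
    · exact isClosed_eq (continuous_finsetSum _ fun i _ => continuous_apply i) continuous_const
  have hcont : Continuous (fun y : ℕ → ℝ => weight G y) :=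
    continuous_finsetSum _ fun A _ => continuous_finsetProd _ fun i _ => continuous_apply i
  have hmem : ∀ z : ℕ → ℝ, (∀ i ∈ S, 0 ≤ z i) → ∑ i ∈ S, z i = 1 →
      (fun i => if i ∈ S then z i else 0) ∈ K := by
    intro z hz hz1
    refine ⟨fun i _ => ?_, ?_⟩
    · by_cases hi : i ∈ S
      · simp only [hi, if_true]
        exact ⟨hz i hi, hz1 ▸ Finset.single_le_sum hz hi⟩
      · simp [hi]
    · change ∑ i ∈ S, (if i ∈ S then z i else 0) = 1
      rw [← hz1]
      exact Finset.sum_congr rfl fun i hi => if_pos hi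
  obtain ⟨s, hs⟩ := hS
  obtain ⟨y, hy, hmax⟩ := hK.exists_isMaxOn
    ⟨_, hmem (Pi.single s 1) (fun i _ => by
      by_cases h : i = s
      · subst h; simp
      · simp [Pi.single_eq_of_ne h]) (by
      rw [Finset.sum_eq_single_of_mem s hs fun i _ h => Pi.single_eq_of_ne h _]; simp)⟩
    hcont.continuousOn
  refine ⟨y, fun i hi => ?_, hy.2, fun z hz hz1 => ?_⟩
  · have := hy.1 i trivial
    simp only [hi, if_true] at this
    exact this.1
  · rw [weight_congr hG (z := fun i => if i ∈ S then z i else 0) fun i hi => (if_pos hi).symm]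
    exact hmax (hmem z hz hz1)

theorem exists_isOptimum {S : Finset ℕ} (hS : S.Nonempty) (m : ℕ) :
    ∃ H y, IsOptimum S m H y := by
  have h : ∀ G : Finset (Finset ℕ), ∃ y : ℕ → ℝ, G ⊆ S.powersetCard 3 → (∀ i ∈ S, 0 ≤ y i) ∧
      ∑ i ∈ S, y i = 1 ∧
      ∀ z : ℕ → ℝ, (∀ i ∈ S, 0 ≤ z i) → ∑ i ∈ S, z i = 1 → weight G z ≤ weight G y := by
    intro G
    by_cases hG : G ⊆ S.powersetCard 3
    · obtain ⟨y, hy⟩ := exists_max_weight hS hG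
      exact ⟨y, fun _ => hy⟩
    · exact ⟨0, fun h => absurd h hG⟩
  choose y hy using h
  obtain ⟨H, hH, hmax⟩ := Finset.exists_max_image
    ((S.powersetCard 3).powerset.filter (fun G => G.card ≤ m)) (fun G => weight G (y G))
    ⟨∅, by simp⟩
  simp only [Finset.mem_filter, Finset.mem_powerset] at hH hmax
  exact ⟨H, y H, hH.1, hH.2, (hy H hH.1).1, (hy H hH.1).2.1, fun G hG hGm z hz hz1 =>
    ((hy G hG).2.2 z hz hz1).trans (hmax G ⟨hG, hGm⟩)⟩

/-- Edges through a vertex of weight zero contribute nothing, so only the edges avoiding q are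
charged to the budget m; H itself may have more than m edges. -/
theorem IsBound.weight_le_of_eq_zero {S : Finset ℕ} {m : ℕ} {c : ℝ} {q : ℕ}
    (hc : IsBound (S.erase q) m c) {H : Finset (Finset ℕ)} (hH : H ⊆ S.powersetCard 3)
    (hm : (H.filter (q ∉ ·)).card ≤ m) {y : ℕ → ℝ} (hy : ∀ i ∈ S, 0 ≤ y i)
    (hy1 : ∑ i ∈ S, y i = 1) (hq : y q = 0) : weight H y ≤ c := by
  have h1 : weight H y = weight (H.filter (q ∉ ·)) y := by
    unfold weight
    rw [Finset.sum_filter]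
    refine Finset.sum_congr rfl fun A _ => ?_
    split_ifs with h
    · exact Finset.prod_eq_zero h hq
    · rfl
  rw [h1]
  refine hc _ (fun A hA => ?_) hm y
    (fun i hi => hy i (mem_of_mem_erase hi)) ?_
  · obtain ⟨h2, h3⟩ := mem_filter.1 hA
    obtain ⟨h4, h5⟩ := mem_powersetCard.1 (hH h2)
    exact mem_powersetCard.2 ⟨fun i hi => mem_erase.2 ⟨fun h => h3 (h ▸ hi), h4 hi⟩, h5⟩
  · rw [Finset.sum_erase _ hq, hy1]

theorem sum_move {S : Finset ℕ} (y : ℕ → ℝ) (s : ℝ) {r q : ℕ} (hr : r ∈ S) (hq : q ∈ S) :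
    ∑ i ∈ S, (y i + s * ((Pi.single r 1 : ℕ → ℝ) i + (-1) * (Pi.single q 1 : ℕ → ℝ) i))
      = ∑ i ∈ S, y i := by
  have h : ∀ a ∈ S, ∑ i ∈ S, (Pi.single a 1 : ℕ → ℝ) i = 1 := fun a ha => by
    rw [Finset.sum_eq_single_of_mem a ha fun i _ h => Pi.single_eq_of_ne h _]; simp
  rw [Finset.sum_add_distrib, ← Finset.mul_sum, Finset.sum_add_distrib, ← Finset.mul_sum, h r hr,
    h q hq]
  ring

theorem move_nonneg {S : Finset ℕ} {y : ℕ → ℝ} (hy : ∀ i ∈ S, 0 ≤ y i) {s : ℝ} (hs : 0 ≤ s)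
    {r q : ℕ} (hsq : s ≤ y q) : ∀ i ∈ S,
    0 ≤ y i + s * ((Pi.single r 1 : ℕ → ℝ) i + (-1) * (Pi.single q 1 : ℕ → ℝ) i) := by
  intro i hi
  have := hy i hi
  by_cases h1 : i = r <;> by_cases h2 : i = q
  · subst h1; subst h2; simp; linarith
  · subst h1; simp [Pi.single_eq_of_ne h2]; linarith
  · subst h2; simp [Pi.single_eq_of_ne h1]; linarith
  · simp [Pi.single_eq_of_ne h1, Pi.single_eq_of_ne h2]; linarith

/-- First-order condition: otherwise moving a small weight s from q to r gains sD/2 and loses only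
s²B. The choice s ≤ D / (4(B + 1)) makes the gain prevail. -/
theorem IsOptimum.link_le {S : Finset ℕ} {m : ℕ} {H : Finset (Finset ℕ)} {y : ℕ → ℝ}
    (h : IsOptimum S m H y) {r q : ℕ} (hr : r ∈ S) (hq : q ∈ S) (hq0 : 0 < y q) :
    link S H y r ≤ link S H y q := by
  by_contra! hlt
  set D := link S H y r - link S H y q with hD
  have hD0 : 0 < D := sub_pos.2 hlt
  set B := ∑ l ∈ S, ind H r q l * y l with hB
  have hB0 : 0 ≤ B := Finset.sum_nonneg fun l hl => mul_nonneg (ind_nonneg _ _ _ _) (h.nonneg l hl)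
  set s := min (y q) (D / (4 * (B + 1))) with hs
  have hs0 : 0 < s := lt_min hq0 (by positivity)
  have hs1 : s * (4 * (B + 1)) ≤ D := by
    rw [← le_div_iff₀ (by positivity)]; exact min_le_right _ _
  have h1 := h.max H h.sub h.card_le _ (move_nonneg h.nonneg hs0.le (min_le_left _ _) (r := r))
    ((sum_move y s hr hq).trans h.sum_eq)
  rw [weight_move h.sub y s hr hq] at h1
  have h2 : s * (D / 2 - s * B) ≤ 0 := by nlinarith
  have h3 : 0 < D / 2 - s * B := by nlinarith
  nlinarith

theorem sum_mul_link {S : Finset ℕ} {G : Finset (Finset ℕ)} (hG : G ⊆ S.powersetCard 3)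
    (y : ℕ → ℝ) : ∑ i ∈ S, y i * link S G y i = 6 * weight G y := by
  rw [← form_eq_sum_link, form_self hG]

/-- The properties of an optimal weighting `y` with full support `S`; the vertex `p` has the
largest weight and lies in no missing triple. -/
structure IsExtremal (S : Finset ℕ) (m : ℕ) (H : Finset (Finset ℕ)) (y : ℕ → ℝ) (p : ℕ) :
    Prop where
  sub : H ⊆ S.powersetCard 3
  card_le : H.card ≤ m
  pos : ∀ i ∈ S, 0 < y i
  sum_eq : ∑ i ∈ S, y i = 1
  mem : p ∈ S
  le : ∀ i ∈ S, y i ≤ y p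
  link_eq : ∀ i ∈ S, link S H y i = 6 * weight H y
  not_mem : ∀ A ∈ S.powersetCard 3 \ H, p ∉ A

/-- The link of p in H is the complete one, which `link_complete` evaluates, and every link equals 6
times the weight. -/
theorem IsExtremal.six_weight {S : Finset ℕ} {m : ℕ} {H : Finset (Finset ℕ)} {y : ℕ → ℝ} {p : ℕ}
    (h : IsExtremal S m H y p) :
    6 * weight H y = 1 - 2 * y p + 2 * y p ^ 2 - ∑ i ∈ S, y i ^ 2 := by
  have h1 := link_sdiff h.sub y p
  have h2 : link S (S.powersetCard 3 \ H) y p = 0 := by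
    refine Finset.sum_eq_zero fun j _ => Finset.sum_eq_zero fun l _ => ?_
    have : ind (S.powersetCard 3 \ H) p j l = 0 := if_neg fun hA => h.not_mem _ hA (by simp)
    rw [this]; ring
  rw [h2, link_complete y h.mem, h.link_eq p h.mem, h.sum_eq] at h1
  linarith

theorem IsExtremal.link_missing {S : Finset ℕ} {m : ℕ} {H : Finset (Finset ℕ)} {y : ℕ → ℝ}
    {p : ℕ} (h : IsExtremal S m H y p) {j : ℕ} (hj : j ∈ S) :
    link S (S.powersetCard 3 \ H) y j = 2 * (y p - y j) * (1 - y p - y j) := by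
  rw [link_sdiff h.sub, link_complete y hj, h.link_eq j hj, h.six_weight, h.sum_eq]
  ring

theorem exists_isExtremal {S : Finset ℕ} {m : ℕ} {c : ℝ} (hbad : ¬ IsBound S m c)
    (hsmall : ∀ q ∈ S, IsBound (S.erase q) m c) :
    ∃ H y p, IsExtremal S m H y p ∧ c < weight H y := by
  have hS : S.Nonempty := by
    by_contra hS
    rw [Finset.not_nonempty_iff_eq_empty] at hS
    subst hS
    exact hbad fun H _ _ y _ h => by simp at h
  obtain ⟨H₀, y, h₀⟩ := exists_isOptimum hS m
  have hc₀ : c < weight H₀ y := by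
    by_contra! hle
    exact hbad fun H hH hm z hz hz1 => (h₀.max H hH hm z hz hz1).trans hle
  obtain ⟨p, hp, hmax⟩ := S.exists_max_image y hS
  -- Tie-break: among the optimal graphs for this fixed y, take one with the most edges through p.
  obtain ⟨H, hH, htie⟩ := Finset.exists_max_image
    ((S.powersetCard 3).powerset.filter (fun G => G.card ≤ m ∧ weight G y = weight H₀ y))
    (fun G => (G.filter (p ∈ ·)).card) ⟨H₀, by simp [h₀.sub, h₀.card_le]⟩
  simp only [Finset.mem_filter, Finset.mem_powerset] at hH htie
  obtain ⟨hsub, hcard, hwt⟩ := hH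
  have h : IsOptimum S m H y := ⟨hsub, hcard, h₀.nonneg, h₀.sum_eq, hwt ▸ h₀.max⟩
  have hc : c < weight H y := hwt ▸ hc₀
  have hpos : ∀ i ∈ S, 0 < y i := fun i hi => by
    refine lt_of_le_of_ne (h.nonneg i hi) fun h0 => not_le.2 hc ?_
    exact (hsmall i hi).weight_le_of_eq_zero h.sub
      ((card_le_card (filter_subset _ _)).trans h.card_le) h.nonneg h.sum_eq h0.symm
  have hlink : ∀ i ∈ S, ∀ j ∈ S, link S H y i = link S H y j := fun i hi j hj =>
    le_antisymm (h.link_le hi hj (hpos j hj)) (h.link_le hj hi (hpos i hi))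
  -- If no edge covers b and e, moving all of e's weight to b has no quadratic term, and equal links
  -- kill the linear one. The value is kept on a smaller vertex set, against `hsmall`.
  have hcov : ∀ b ∈ S, ∀ e ∈ S, b ≠ e → ∃ i ∈ S, ({b, e, i} : Finset ℕ) ∈ H := by
    intro b hb e he hbe
    by_contra! hno
    refine not_le.2 hc ?_
    have h1 := weight_move h.sub y (y e) hb he
    have h2 : ∑ l ∈ S, ind H b e l * y l = 0 :=
      Finset.sum_eq_zero fun l hl => by rw [ind, if_neg (hno l hl), zero_mul]
    rw [h2, hlink b hb e he] at h1
    have h3 : weight H y = weight H (fun i => y i + y e *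
      ((Pi.single b 1 : ℕ → ℝ) i + (-1) * (Pi.single e 1 : ℕ → ℝ) i)) := by rw [h1]; ring
    rw [h3]
    refine (hsmall e he).weight_le_of_eq_zero h.sub
      ((card_le_card (filter_subset _ _)).trans h.card_le)
      (move_nonneg h.nonneg (hpos e he).le le_rfl) ((sum_move y _ hb he).trans h.sum_eq) ?_
    simp [Pi.single_eq_of_ne hbe.symm]
  refine ⟨H, y, p, ⟨h.sub, h.card_le, hpos, h.sum_eq, hp, hmax, fun i hi => ?_, ?_⟩, hc⟩
  · rw [← sum_mul_link h.sub, Finset.sum_congr rfl fun j hj => by rw [hlink j hj i hi],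
      ← Finset.sum_mul, h.sum_eq, one_mul]
  intro A hA hpA
  obtain ⟨hA1, hA2⟩ := mem_sdiff.1 hA
  obtain ⟨hAS, hA3⟩ := mem_powersetCard.1 hA1
  have h4 : (A.erase p).card = 2 := by rw [card_erase_of_mem hpA, hA3]
  obtain ⟨b, e, hbe, hAe⟩ := card_eq_two.1 h4
  have hb : b ∈ A.erase p := by simp [hAe]
  have he : e ∈ A.erase p := by simp [hAe]
  have hAeq : A = {b, e, p} := by
    rw [← insert_erase hpA, hAe]; ext x; simp; tauto
  obtain ⟨i, hi, hiH⟩ := hcov b (hAS (mem_of_mem_erase hb)) e (hAS (mem_of_mem_erase he)) hbe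
  obtain ⟨-, hbi, hei⟩ := ne_of_mem h.sub hiH
  have hip : i ≠ p := by rintro rfl; exact hA2 (hAeq ▸ hiH)
  have hbp : b ≠ p := ne_of_mem_erase hb
  have hep : e ≠ p := ne_of_mem_erase he
  set B : Finset ℕ := {b, e, i} with hB
  have hAB : A ∉ H.erase B := fun hh => hA2 (mem_of_mem_erase hh)
  have hsub' : insert A (H.erase B) ⊆ S.powersetCard 3 :=
    insert_subset hA1 ((erase_subset _ _).trans h.sub)
  have hcard' : (insert A (H.erase B)).card ≤ m := by
    rw [card_insert_of_notMem hAB, card_erase_add_one hiH]; exact h.card_le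
  -- Exchanging B for A loses no weight since p is heaviest, so the new graph is again optimal, but
  -- it has one more edge through p.
  have hw : weight (insert A (H.erase B)) y = weight H y + y b * y e * (y p - y i) := by
    unfold weight
    rw [sum_insert hAB, ← add_sum_erase H _ hiH, hAeq, hB]
    simp [hbe, hbi, hei, hbp, hep]
    ring
  have hpi : 0 ≤ y b * y e * (y p - y i) :=
    mul_nonneg (mul_nonneg (hpos b (hAS (mem_of_mem_erase hb))).le
      (hpos e (hAS (mem_of_mem_erase he))).le) (sub_nonneg.2 (hmax i hi))
  have hle := h.max _ hsub' hcard' y h.nonneg h.sum_eq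
  have h5 := htie _ ⟨hsub', hcard', by linarith⟩
  have h6 : (insert A (H.erase B)).filter (p ∈ ·) = insert A (H.filter (p ∈ ·)) := by
    rw [filter_insert, if_pos hpA, filter_erase, erase_eq_of_notMem]
    intro hh
    have := (mem_filter.1 hh).2
    simp [hB, hbp.symm, hep.symm, hip.symm] at this
  rw [h6, card_insert_of_notMem fun hh => hA2 (mem_filter.1 hh).1] at h5
  omega


/-! ### Supports with at most n or at least n + 2 vertices -/

/-- The Lagrangian of the complete `3`-graph on at most `n` vertices. -/
theorem isBound_of_card_le {S : Finset ℕ} {m n : ℕ} (hn : 4 ≤ n) (hS : S.card ≤ n) :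
    IsBound S m ((1 - 3 / (n : ℝ) + 2 / (n : ℝ) ^ 2) / 6) := by
  intro H hH _ y hy hy1
  have h1 := weight_mono hH subset_rfl hy
  have h2 := weight_complete (S := S) y
  rw [hy1] at h2
  have hn' : (4 : ℝ) ≤ n := by exact_mod_cast hn
  set c : ℝ := (n : ℝ)⁻¹ with hc
  have hc0 : 0 < c := by positivity
  have hnc : (n : ℝ) * c = 1 := mul_inv_cancel₀ (by positivity)
  have hc4 : c ≤ 1 / 4 := by nlinarith
  have hcard : (S.card : ℝ) ≤ n := by exact_mod_cast hS
  -- The left side is the tangent line of 3y² - 2y³ at y = c; the gap is (y - c)²(3 - 2y - 4c).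
  have h3 : ∑ i ∈ S, ((-3 * c ^ 2 + 4 * c ^ 3) + (6 * c - 6 * c ^ 2) * y i)
      ≤ ∑ i ∈ S, (3 * y i ^ 2 - 2 * y i ^ 3) := by
    refine Finset.sum_le_sum fun i hi => ?_
    have hi1 : y i ≤ 1 := hy1 ▸ Finset.single_le_sum hy hi
    nlinarith [mul_nonneg (sq_nonneg (y i - c)) (by linarith : 0 ≤ 3 - 2 * y i - 4 * c)]
  rw [Finset.sum_add_distrib, ← Finset.mul_sum, Finset.sum_sub_distrib, ← Finset.mul_sum,
    ← Finset.mul_sum, hy1, Finset.sum_const, nsmul_eq_mul] at h3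
  -- The intercept is nonpositive, so having fewer than n vertices only helps.
  have h4 : (n : ℝ) * (-3 * c ^ 2 + 4 * c ^ 3) ≤ S.card * (-3 * c ^ 2 + 4 * c ^ 3) := by
    have : -3 * c ^ 2 + 4 * c ^ 3 ≤ 0 := by nlinarith [sq_nonneg c]
    nlinarith
  have h5 : (n : ℝ) * (-3 * c ^ 2 + 4 * c ^ 3) = -3 * c + 4 * c ^ 2 := by
    linear_combination (-3 * c + 4 * c ^ 2) * hnc
  have h6 : 1 - 3 / (n : ℝ) + 2 / (n : ℝ) ^ 2 = 1 - 3 * c + 2 * c ^ 2 := by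
    rw [hc, inv_pow]; ring
  rw [h6]
  linarith

namespace IsExtremal

variable {S : Finset ℕ} {m : ℕ} {H : Finset (Finset ℕ)} {y : ℕ → ℝ} {p : ℕ}

theorem sq_le_sum_sq (h : IsExtremal S m H y p) : y p ^ 2 ≤ ∑ i ∈ S, y i ^ 2 :=
  Finset.single_le_sum (f := fun i => y i ^ 2) (fun _ _ => sq_nonneg _) h.mem

theorem sum_sq_le (h : IsExtremal S m H y p) : ∑ i ∈ S, y i ^ 2 ≤ y p := by
  have : ∑ i ∈ S, y i ^ 2 ≤ ∑ i ∈ S, y p * y i := Finset.sum_le_sum fun i hi => by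
    have := h.le i hi; have := h.pos i hi; nlinarith
  rwa [← Finset.mul_sum, h.sum_eq, mul_one] at this

theorem le_one (h : IsExtremal S m H y p) : y p ≤ 1 :=
  h.sum_eq ▸ Finset.single_le_sum (fun i hi => (h.pos i hi).le) h.mem

/-- The sum of squares is at least `y p ^ 2`, so six times the weight is at most (1 - y_p)²; for y_p
≥ 2r this is at most (1 - 2r)² ≤ 1 - 3r + 2r². -/
theorem lt_two_mul (h : IsExtremal S m H y p) {r : ℝ} (hr0 : 0 < r) (hr1 : r ≤ 1 / 4)
    (hr : 1 - 3 * r + 2 * r ^ 2 < 6 * weight H y) : y p < 2 * r := by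
  have h1 := h.six_weight
  have h2 := h.sq_le_sum_sq
  have h3 := h.le_one
  by_contra! h4
  nlinarith

/-- Cauchy–Schwarz over the edges: the squared weight is at most e(H) times the weight at y², and
these factors are at most t³/6 and P³/6, with P the sum of squares. -/
theorem sq_six_weight_le (h : IsExtremal S m H y p) {t : ℕ} (hm : m ≤ t.choose 3) :
    (6 * weight H y) ^ 2 ≤ (t * ∑ i ∈ S, y i ^ 2) ^ 3 := by
  set P := ∑ i ∈ S, y i ^ 2 with hP
  have h1 : weight H y ^ 2 ≤ H.card * weight H (fun i => y i ^ 2) := by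
    unfold weight
    refine sq_sum_le_card_mul_sum_sq.trans_eq ?_
    simp [Finset.prod_pow]
  have h2 : weight H (fun i => y i ^ 2) ≤ weight (S.powersetCard 3) (fun i => y i ^ 2) :=
    weight_mono h.sub subset_rfl fun i _ => sq_nonneg _
  have h3 := weight_complete (S := S) (fun i => y i ^ 2)
  have hP0 : 0 ≤ P := Finset.sum_nonneg fun i _ => sq_nonneg _
  have h4 : ∑ i ∈ S, (y i ^ 2) ^ 3 ≤ P * ∑ i ∈ S, (y i ^ 2) ^ 2 := by
    rw [Finset.mul_sum]
    refine Finset.sum_le_sum fun i hi => ?_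
    have : y i ^ 2 ≤ P := Finset.single_le_sum (f := fun i => y i ^ 2) (fun i _ => sq_nonneg _) hi
    have h5 : 0 ≤ (y i ^ 2) ^ 2 := by positivity
    calc (y i ^ 2) ^ 3 = y i ^ 2 * (y i ^ 2) ^ 2 := by ring
      _ ≤ _ := mul_le_mul_of_nonneg_right this h5
  have h5 : 0 ≤ P * ∑ i ∈ S, (y i ^ 2) ^ 2 :=
    mul_nonneg hP0 (Finset.sum_nonneg fun i _ => by positivity)
  have h6 : 6 * weight H (fun i => y i ^ 2) ≤ P ^ 3 := by
    change _ = P ^ 3 - 3 * P * _ + _ at h3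
    linarith
  have h7 : (H.card : ℝ) ≤ (t : ℝ) ^ 3 / 6 := by
    have h8 : (H.card : ℝ) ≤ t.choose 3 := by exact_mod_cast h.card_le.trans hm
    have h9 := Nat.choose_le_pow_div (α := ℝ) 3 t
    have : ((Nat.factorial 3 : ℕ) : ℝ) = 6 := by norm_num [Nat.factorial]
    rw [this] at h9
    linarith
  have h8 : (H.card : ℝ) * weight H (fun i => y i ^ 2) ≤ (t : ℝ) ^ 3 / 6 * (P ^ 3 / 6) :=
    mul_le_mul h7 (by linarith) (Finset.sum_nonneg fun A _ => Finset.prod_nonneg fun i _ =>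
      sq_nonneg _) (by positivity)
  rw [mul_pow, mul_pow]
  linarith

/-- The edge count alone forces the sum of squares up to about 1/n, with no control on the size of
S. -/
theorem sum_sq_ge (h : IsExtremal S m H y p) {n : ℕ} (hn : 10 ≤ n) (hm : m ≤ (n + 1).choose 3)
    (hr : 1 - 3 * (n : ℝ)⁻¹ + 2 * (n : ℝ)⁻¹ ^ 2 < 6 * weight H y) :
    (n : ℝ)⁻¹ - 7 * (n : ℝ)⁻¹ ^ 2 ≤ ∑ i ∈ S, y i ^ 2 := by
  have h1 := h.sq_six_weight_le hm
  have hn' : (10 : ℝ) ≤ n := by exact_mod_cast hn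
  set r : ℝ := (n : ℝ)⁻¹ with hrdef
  have hr0 : 0 < r := by positivity
  have hnr : (n : ℝ) * r = 1 := mul_inv_cancel₀ (by positivity)
  have hr1 : r ≤ 1 / 10 := by nlinarith
  set P := ∑ i ∈ S, y i ^ 2 with hP
  have hP0 : 0 ≤ P := Finset.sum_nonneg fun i _ => sq_nonneg _
  push_cast at h1
  have hX0 : 0 ≤ ((n : ℝ) + 1) * P := by positivity
  have hX : 1 - 6 * r ≤ ((n : ℝ) + 1) * P := by
    rcases le_or_gt 1 (((n : ℝ) + 1) * P) with h2 | h2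
    · linarith
    · have h3 : (1 - 3 * r) ^ 2 ≤ (6 * weight H y) ^ 2 := by
        refine pow_le_pow_left₀ (by linarith) ?_ 2
        nlinarith
      have h4 : (((n : ℝ) + 1) * P) ^ 3 ≤ ((n : ℝ) + 1) * P :=
        pow_le_of_le_one hX0 h2.le (by norm_num)
      nlinarith
  have h5 : r * (1 - 6 * r) ≤ (1 + r) * P := by
    have : r * (((n : ℝ) + 1) * P) = (1 + r) * P := by linear_combination P * hnr
    rw [← this]
    exact mul_le_mul_of_nonneg_left hX hr0.le
  by_contra! h6
  nlinarith

end IsExtremal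

/-- Adding missing triples outside `q` to compensate for the loss of the vertex `q`. -/
theorem IsExtremal.false_of_compensation {S : Finset ℕ} {m : ℕ} {H : Finset (Finset ℕ)}
    {y : ℕ → ℝ} {p : ℕ} (h : IsExtremal S m H y p) {c : ℝ} (hc : c < weight H y) {q : ℕ}
    (hq : q ∈ S) (hpq : p ≠ q) (hsmall : IsBound (S.erase q) m c) {G : Finset (Finset ℕ)}
    (hG : G ⊆ (S.powersetCard 3 \ H).filter (q ∉ ·)) (hGcard : G.card ≤ (H.filter (q ∈ ·)).card)
    (hGw : y q ^ 2 ≤ weight G y) : False := by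
  have hy := fun i hi => (h.pos i hi).le
  have hG1 : G ⊆ S.powersetCard 3 := fun A hA => (mem_sdiff.1 (mem_filter.1 (hG hA)).1).1
  have hdisj : Disjoint H G := Finset.disjoint_right.2 fun A hA =>
    (mem_sdiff.1 (mem_filter.1 (hG hA)).1).2
  set y' : ℕ → ℝ := fun i => y i + y q *
    ((Pi.single p 1 : ℕ → ℝ) i + (-1) * (Pi.single q 1 : ℕ → ℝ) i) with hy'
  -- Equal links remove the linear term, so emptying q costs at most `y q ^ 2`.
  have h1 : weight H y' = weight H y - y q ^ 2 * ∑ l ∈ S, ind H p q l * y l := by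
    rw [hy', weight_move h.sub y (y q) h.mem hq, h.link_eq p h.mem, h.link_eq q hq]; ring
  have h2 : ∑ l ∈ S, ind H p q l * y l ≤ 1 := by
    rw [← h.sum_eq]
    exact Finset.sum_le_sum fun l hl =>
      mul_le_of_le_one_left (hy l hl) (ind_le_one _ _ _ _)
  have h3 : weight G y ≤ weight G y' := by
    refine Finset.sum_le_sum fun A hA => Finset.prod_le_prod
      (fun i hi => hy i ((mem_powersetCard.1 (hG1 hA)).1 hi)) fun i hi => ?_
    have hiq : i ≠ q := fun e => (mem_filter.1 (hG hA)).2 (e ▸ hi)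
    have hq0 : (Pi.single q 1 : ℕ → ℝ) i = 0 := Pi.single_eq_of_ne hiq _
    simp only [hy', hq0]
    have : 0 ≤ (Pi.single p 1 : ℕ → ℝ) i := by
      by_cases e : i = p
      · subst e; simp
      · simp [Pi.single_eq_of_ne e]
    have := mul_nonneg (hy q hq) this
    linarith
  have h4 : weight (H ∪ G) y' = weight H y' + weight G y' := Finset.sum_union hdisj
  have h5 : weight (H ∪ G) y' ≤ c := by
    refine hsmall.weight_le_of_eq_zero (union_subset h.sub hG1) ?_
      (move_nonneg hy (hy q hq) le_rfl) ((sum_move y _ h.mem hq).trans h.sum_eq) ?_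
    · rw [filter_union]
      refine (card_union_le _ _).trans ?_
      have h6 := card_filter_add_card_filter_not (s := H) (q ∈ ·)
      have h7 := card_filter_le G (q ∉ ·)
      have := h.card_le
      omega
    · have hq0 : (Pi.single p 1 : ℕ → ℝ) q = 0 := Pi.single_eq_of_ne hpq.symm _
      simp only [hy', hq0, Pi.single_eq_same]
      ring
  have h6 : y q ^ 2 * ∑ l ∈ S, ind H p q l * y l ≤ y q ^ 2 :=
    mul_le_of_le_one_right (sq_nonneg _) h2
  linarith

/-- Each pair in the link of q weighs at most `y p ^ 2`, while the link is as large as 6 times the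
weight. -/
theorem IsExtremal.one_le_degree {S : Finset ℕ} {m : ℕ} {H : Finset (Finset ℕ)}
    {y : ℕ → ℝ} {p : ℕ} (h : IsExtremal S m H y p) (hw : 1 / 2 ≤ 6 * weight H y) {q : ℕ}
    (hq : q ∈ S) : 1 ≤ 4 * ((H.filter (q ∈ ·)).card : ℝ) * y p ^ 2 := by
  have h1 := weight_filter_mem h.sub (fun _ => 1) hq
  rw [weight_one] at h1
  have h2 : link S H y q ≤ y p ^ 2 * link S H (fun _ => 1) q := by
    unfold link
    simp only [Finset.mul_sum]
    refine Finset.sum_le_sum fun j hj => Finset.sum_le_sum fun l hl => ?_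
    have h3 : y j * y l ≤ y p ^ 2 := by
      rw [sq]
      exact mul_le_mul (h.le j hj) (h.le l hl) (h.pos l hl).le (h.pos p h.mem).le
    have := mul_le_mul_of_nonneg_left h3 (ind_nonneg H q j l)
    linarith
  rw [h.link_eq q hq] at h2
  nlinarith

/-- Restricting the link of `j` in the missing triples to the triples that avoid `q` and have a
vertex of weight at least `c`. -/
theorem link_sub_le {S : Finset ℕ} {H : Finset (Finset ℕ)} {y : ℕ → ℝ}
    (hpos : ∀ i ∈ S, 0 < y i) (hsum : ∑ i ∈ S, y i = 1) {q j : ℕ} (hq : q ∈ S) (hjq : j ≠ q)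
    {c : ℝ} :
    link S (S.powersetCard 3 \ H) y j - 2 * y q
        - (∑ b ∈ S, if y b < c then y b else 0) ^ 2
      ≤ link S (((S.powersetCard 3 \ H).filter (q ∉ ·)).filter
          (fun A => j ∈ A ∧ ∃ b ∈ A, c ≤ y b)) y j := by
  set G₀ := ((S.powersetCard 3 \ H).filter (q ∉ ·)).filter
    (fun A => j ∈ A ∧ ∃ b ∈ A, c ≤ y b) with hG₀
  set σ := ∑ b ∈ S, (if y b < c then y b else 0) with hσ
  -- A pair is lost either because it contains q, at total cost at most 2 y_q, or because both its
  -- ends are light, at total cost at most σ². Written as double sums, these errors can be compared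
  -- termwise.
  have e1 : ∑ b ∈ S, ∑ l ∈ S, (if b = q then y b * y l else 0) = y q := by
    rw [Finset.sum_eq_single_of_mem q hq fun b _ hb => by simp [hb]]
    simp [← Finset.mul_sum, hsum]
  have e2 : ∑ b ∈ S, ∑ l ∈ S, (if l = q then y b * y l else 0) = y q := by
    rw [Finset.sum_comm, ← e1]
    exact Finset.sum_congr rfl fun b _ => Finset.sum_congr rfl fun l _ => by rw [mul_comm]
  have e3 : ∑ b ∈ S, ∑ l ∈ S, (if y b < c then y b else 0) *
      (if y l < c then y l else 0) = σ ^ 2 := by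
    rw [sq, hσ, Finset.sum_mul_sum]
  have e4 : link S (S.powersetCard 3 \ H) y j - 2 * y q - σ ^ 2
      = link S (S.powersetCard 3 \ H) y j - y q - y q - σ ^ 2 := by ring
  rw [e4, ← e3]
  nth_rewrite 1 [← e1]
  nth_rewrite 1 [← e2]
  unfold link
  simp only [← Finset.sum_sub_distrib]
  refine Finset.sum_le_sum fun b hb => Finset.sum_le_sum fun l hl => ?_
  have hb0 := hpos b hb
  have hl0 := hpos l hl
  have hbl := mul_pos hb0 hl0
  have i1 : (0 : ℝ) ≤ if b = q then y b * y l else 0 := by split_ifs <;> linarith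
  have i2 : (0 : ℝ) ≤ if l = q then y b * y l else 0 := by split_ifs <;> linarith
  have i3 : (0 : ℝ) ≤ (if y b < c then y b else 0) * (if y l < c then y l else 0) :=
    mul_nonneg (by split_ifs <;> linarith) (by split_ifs <;> linarith)
  by_cases hF1 : ({j, b, l} : Finset ℕ) ∈ S.powersetCard 3 \ H
  · by_cases hG1 : ({j, b, l} : Finset ℕ) ∈ G₀
    · simp only [ind, hF1, hG1, if_true]; linarith
    · simp only [ind, hF1, hG1, if_true, if_false]
      by_cases hbq : b = q
      · rw [if_pos hbq] at i1 ⊢; linarith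
      by_cases hlq : l = q
      · rw [if_pos hlq] at i2 ⊢; linarith
      have hF2 : ({j, b, l} : Finset ℕ) ∈ (S.powersetCard 3 \ H).filter (q ∉ ·) := mem_filter.2 ⟨hF1, by
        simp [hjq.symm, Ne.symm hbq, Ne.symm hlq]⟩
      have hsm : ∀ x ∈ ({j, b, l} : Finset ℕ), y x < c := by
        intro x hx
        by_contra! hxa
        exact hG1 (mem_filter.2 ⟨hF2, by simp, x, hx, hxa⟩)
      rw [if_pos (hsm b (by simp)), if_pos (hsm l (by simp)), if_neg hbq, if_neg hlq]
      linarith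
  · have i4 := mul_nonneg (mul_nonneg (ind_nonneg G₀ j b l) hb0.le) hl0.le
    have : ind (S.powersetCard 3 \ H) j b l = 0 := if_neg hF1
    rw [this]
    linarith

/-- With r = 1/n and P the sum of squares, `six_weight` gives 2 y_p + P < 3r + O(r²), and P ≥ r -
7r²; so y_p exceeds P by O(r²) only. -/
theorem IsExtremal.weight_bounds {S : Finset ℕ} {m : ℕ} {H : Finset (Finset ℕ)}
    {y : ℕ → ℝ} {p : ℕ} (h : IsExtremal S m H y p) {n : ℕ} (hn : 20000 ≤ n)
    (hm : m ≤ (n + 1).choose 3)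
    (hr : 1 - 3 * (n : ℝ)⁻¹ + 2 * (n : ℝ)⁻¹ ^ 2 < 6 * weight H y) :
    (n : ℝ)⁻¹ / 2 ≤ y p ∧ y p < 2 * (n : ℝ)⁻¹ ∧
      y p - ∑ i ∈ S, y i ^ 2 ≤ 15 * (n : ℝ)⁻¹ ^ 2 ∧ 1 / 2 ≤ 6 * weight H y := by
  have hP := h.sum_sq_ge (by omega) hm hr
  have hn' : (20000 : ℝ) ≤ n := by exact_mod_cast hn
  set r : ℝ := (n : ℝ)⁻¹ with hrdef
  have hr0 : 0 < r := by positivity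
  have hnr : (n : ℝ) * r = 1 := mul_inv_cancel₀ (by positivity)
  have hr1 : r ≤ 1 / 20000 := by nlinarith
  have ha2 := h.lt_two_mul hr0 (by linarith) hr
  have hPa := h.sum_sq_le
  have hsix := h.six_weight
  set P := ∑ i ∈ S, y i ^ 2 with hPdef
  set a := y p with ha
  have ha0 : 0 < a := h.pos p h.mem
  exact ⟨by nlinarith, ha2, by nlinarith, by nlinarith⟩

theorem IsExtremal.exists_compensation {S : Finset ℕ} {m : ℕ} {H : Finset (Finset ℕ)}
    {y : ℕ → ℝ} {p : ℕ} (h : IsExtremal S m H y p) {n : ℕ} (hn : 20000 ≤ n)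
    (hm : m ≤ (n + 1).choose 3)
    (hr : 1 - 3 * (n : ℝ)⁻¹ + 2 * (n : ℝ)⁻¹ ^ 2 < 6 * weight H y) (hS : n + 2 ≤ S.card)
    {q : ℕ} (hq : q ∈ S) (hqmin : ∀ i ∈ S, y q ≤ y i) :
    ∃ G ⊆ (S.powersetCard 3 \ H).filter (q ∉ ·), G.card ≤ (H.filter (q ∈ ·)).card ∧
      y q ^ 2 ≤ weight G y := by
  have hn' : (20000 : ℝ) ≤ n := by exact_mod_cast hn
  obtain ⟨har, ha2, haP, hw⟩ := h.weight_bounds hn hm hr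
  have hdeg := h.one_le_degree hw hq
  clear hw hr
  set r : ℝ := (n : ℝ)⁻¹ with hrdef
  have hr0 : 0 < r := by positivity
  have hnr : (n : ℝ) * r = 1 := mul_inv_cancel₀ (by positivity)
  have hr1 : r ≤ 1 / 20000 := by nlinarith
  clear hnr hrdef
  set P := ∑ i ∈ S, y i ^ 2 with hPdef
  set a := y p with ha
  set e := (H.filter (q ∈ ·)).card with he
  have ha0 : 0 < a := h.pos p h.mem
  have hq0 : 0 < y q := h.pos q hq
  have hqa : y q ≤ a := h.le q hq
  have hea : 1 ≤ (e : ℝ) * a := by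
    have : (0 : ℝ) ≤ e := by positivity
    nlinarith [mul_nonneg this ha0.le]
  set F := (S.powersetCard 3 \ H).filter (q ∉ ·) with hF
  -- As |S| - 1 ≥ n + 1, there are at least m triples avoiding q, while H has at most m edges, e of
  -- them through q.
  have hFcard : e ≤ F.card := by
    have h1 : ((S.erase q).powersetCard 3) ⊆ F ∪ H.filter (q ∉ ·) := by
      intro A hA
      obtain ⟨h2, h3⟩ := mem_powersetCard.1 hA
      have h4 : q ∉ A := fun h => (mem_erase.1 (h2 h)).1 rfl
      have h5 : A ∈ S.powersetCard 3 := mem_powersetCard.2 ⟨h2.trans (erase_subset _ _), h3⟩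
      by_cases hAH : A ∈ H <;> simp only [hF, mem_union, mem_filter, mem_sdiff] <;> tauto
    have h2 := (card_le_card h1).trans (card_union_le _ _)
    rw [card_powersetCard, card_erase_of_mem hq] at h2
    have h3 : (n + 1).choose 3 ≤ (S.card - 1).choose 3 := Nat.choose_le_choose 3 (by omega)
    have h4 := card_filter_add_card_filter_not (s := H) (q ∈ ·)
    have := h.card_le
    omega
  have hFS : ∀ A ∈ F, A ⊆ S ∧ A.card = 3 := fun A hA =>
    mem_powersetCard.1 (mem_sdiff.1 (mem_filter.1 hA).1).1
  -- If every vertex other than q is heavy, any e missing triples weigh enough. Otherwise a light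
  -- vertex j has a large missing link, and triples through j are used.
  by_cases hcase : ∀ j ∈ S, j ≠ q → a / 4 ≤ y j
  · obtain ⟨G, hGF, hGe⟩ := exists_subset_card_eq hFcard
    refine ⟨G, hGF, hGe.le, ?_⟩
    have h1 : (e : ℝ) * (a / 4) ^ 3 ≤ weight G y := by
      rw [← hGe, ← nsmul_eq_mul]
      refine card_nsmul_le_sum _ _ _ fun A hA => ?_
      rw [show (a / 4) ^ 3 = ∏ i ∈ A, a / 4 by rw [prod_const, (hFS A (hGF hA)).2]]
      refine prod_le_prod (fun i _ => by positivity) fun i hi => ?_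
      exact hcase i ((hFS A (hGF hA)).1 hi) fun e => (mem_filter.1 (hGF hA)).2 (e ▸ hi)
    have h2 : a / 256 ≤ (e : ℝ) * (a / 4) ^ 3 := by nlinarith
    nlinarith
  push Not at hcase
  obtain ⟨j, hj, hjq, hja⟩ := hcase
  have hqj := hqmin j hj
  set G₀ := F.filter (fun A => j ∈ A ∧ ∃ b ∈ A, a / 4 ≤ y b) with hG₀
  have hG₀sub : G₀ ⊆ S.powersetCard 3 := fun A hA =>
    mem_powersetCard.2 (hFS A (mem_filter.1 hA).1)
  set σ := ∑ b ∈ S, (if y b < a / 4 then y b else 0) with hσ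
  have hσ0 : 0 ≤ σ := Finset.sum_nonneg fun b hb => by
    split_ifs
    · exact (h.pos b hb).le
    · exact le_rfl
  -- Each light vertex b contributes y_b(a - y_b) ≥ (3a/4) y_b to a - P, so the total light weight
  -- is O(1/n).
  have hσ1 : 3 * a / 4 * σ ≤ a - P := by
    have h1 : a - P = ∑ b ∈ S, (a * y b - y b ^ 2) := by
      rw [Finset.sum_sub_distrib, ← Finset.mul_sum, h.sum_eq, mul_one]
    rw [h1, hσ, Finset.mul_sum]
    refine Finset.sum_le_sum fun b hb => ?_
    have h2 := h.pos b hb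
    have h3 := h.le b hb
    split_ifs with h4
    · nlinarith [mul_pos h2 (sub_pos.2 h4)]
    · nlinarith [mul_nonneg h2.le (sub_nonneg.2 h3)]
  have hσ2 : σ ≤ 40 * r := by
    have h1 : r / 2 * σ ≤ a * σ := mul_le_mul_of_nonneg_right har hσ0
    refine le_of_mul_le_mul_left ?_ hr0
    linarith
  have hlink : link S (S.powersetCard 3 \ H) y j - 2 * y q - σ ^ 2 ≤ link S G₀ y j :=
    link_sub_le h.pos h.sum_eq hq hjq
  have hG₀w : 2 * weight G₀ y = y j * link S G₀ y j := by
    rw [← weight_filter_mem hG₀sub y hj, filter_true_of_mem fun A hA => (mem_filter.1 hA).2.1]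
  rw [h.link_missing hj] at hlink
  have hj0 := h.pos j hj
  have hl8 : 0.8 * a ≤ link S G₀ y j := by
    have h1 : 1.5 * a - 2 * a ^ 2 ≤ 2 * (a - y j) * (1 - a - y j) := by
      have h4 : 3 * a / 4 * (1 - 5 * a / 4) ≤ (a - y j) * (1 - a - y j) :=
        mul_le_mul (by linarith) (by linarith) (by linarith) (by linarith)
      linarith [sq_nonneg a]
    have h2 : σ ^ 2 ≤ 0.16 * a := by
      have h4 : σ ^ 2 ≤ (40 * r) ^ 2 := pow_le_pow_left₀ hσ0 hσ2 2
      have h5 : r * r ≤ 1 / 20000 * r := mul_le_mul_of_nonneg_right hr1 hr0.le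
      linarith
    have h3 : a ^ 2 ≤ 0.001 * a := by
      rw [sq]; exact mul_le_mul_of_nonneg_right (by linarith) ha0.le
    linarith
  -- Either all of G₀ fits the budget and weighs at least 0.4 a y_j, or e of its triples do, each
  -- weighing at least (a/4) y_q² thanks to its heavy vertex.
  by_cases hsize : G₀.card ≤ e
  · refine ⟨G₀, filter_subset _ _, hsize, ?_⟩
    have h1 : y q * y q ≤ y j * (0.4 * a) :=
      mul_le_mul hqj (by linarith) hq0.le hj0.le
    have h2 : y j * (0.8 * a) ≤ y j * link S G₀ y j := mul_le_mul_of_nonneg_left hl8 hj0.le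
    linarith
  · obtain ⟨G, hGG, hGe⟩ := exists_subset_card_eq (not_le.1 hsize).le
    refine ⟨G, hGG.trans (filter_subset _ _), hGe.le, ?_⟩
    have h1 : (e : ℝ) * (a / 4 * y q ^ 2) ≤ weight G y := by
      rw [← hGe, ← nsmul_eq_mul]
      refine card_nsmul_le_sum _ _ _ fun A hA => ?_
      obtain ⟨hAF, hjA, b, hb, hba⟩ := mem_filter.1 (hGG hA)
      obtain ⟨hAS, hA3⟩ := hFS A hAF
      have hbj : b ≠ j := by rintro rfl; linarith
      have hbA : b ∈ A.erase j := mem_erase.2 ⟨hbj, hb⟩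
      have h3 : ((A.erase j).erase b).card = 1 := by
        rw [card_erase_of_mem hbA, card_erase_of_mem hjA, hA3]
      obtain ⟨x, hx⟩ := card_eq_one.1 h3
      have hxS : x ∈ S := hAS (mem_of_mem_erase (mem_of_mem_erase (by rw [hx]; simp)))
      rw [← mul_prod_erase A y hjA, ← mul_prod_erase _ y hbA, hx, prod_singleton]
      have hqx := hqmin x hxS
      have h4 : y q * y q ≤ y j * y x := mul_le_mul hqj hqx hq0.le hj0.le
      have h5 : 0 ≤ y j * y x := (mul_pos hj0 (h.pos x hxS)).le
      nlinarith
    have h2 : 1 ≤ (e : ℝ) * (a / 4) := by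
      have : (0 : ℝ) ≤ e := by positivity
      have h3 : 1 ≤ 4 * ((e : ℝ) * a) * a := by linarith
      nlinarith
    have h3 : y q ^ 2 ≤ (e : ℝ) * (a / 4) * y q ^ 2 := le_mul_of_one_le_left (sq_nonneg _) h2
    linarith

/-- The support of an optimal weighting has at most `n + 1` vertices. -/
theorem IsExtremal.false_of_large {S : Finset ℕ} {m : ℕ} {H : Finset (Finset ℕ)}
    {y : ℕ → ℝ} {p : ℕ} (h : IsExtremal S m H y p) {n : ℕ} (hn : 20000 ≤ n)
    (hm : m ≤ (n + 1).choose 3) {c : ℝ}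
    (hr : 1 - 3 * (n : ℝ)⁻¹ + 2 * (n : ℝ)⁻¹ ^ 2 < 6 * weight H y) (hS : n + 2 ≤ S.card)
    (hc : c < weight H y) (hsmall : ∀ q ∈ S, IsBound (S.erase q) m c) : False := by
  obtain ⟨q, hq, hqmin⟩ := (S.erase p).exists_min_image y (by
    rw [← card_pos, card_erase_of_mem h.mem]; omega)
  have hqS := mem_of_mem_erase hq
  have hqmin' : ∀ i ∈ S, y q ≤ y i := fun i hi => by
    by_cases hip : i = p
    · rw [hip]; exact h.le q hqS
    · exact hqmin i (mem_erase.2 ⟨hip, hi⟩)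
  obtain ⟨G, hG, hGc, hGw⟩ := h.exists_compensation hn hm hr hS hqS hqmin'
  exact h.false_of_compensation hc hqS (ne_of_mem_erase hq).symm (hsmall q hqS) hG hGc hGw


/-! ### Counting the missing triples on n + 1 vertices -/

variable {F : Finset (Finset ℕ)}

theorem weight_eq_filter_add (F : Finset (Finset ℕ)) (q : ℕ) (y : ℕ → ℝ) :
    weight F y = weight (F.filter (q ∈ ·)) y + weight (F.filter (q ∉ ·)) y :=
  (Finset.sum_filter_add_sum_filter_not F (q ∈ ·) _).symm

/-- The number of triples, split according to `q`, with `1` expanded as `u + d`. -/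
theorem card_eq_of_add_eq_one (hF : F ⊆ S.powersetCard 3) {q : ℕ} (hq : q ∈ S) {u d : ℕ → ℝ}
    (hud : ∀ i, u i + d i = 1) :
    (F.card : ℝ) = (F.filter (q ∉ ·)).card + link S F u q / 2
      + ∑ a ∈ S, ∑ b ∈ S, ind F q a b * d a * u b + link S F d q / 2 := by
  have h1 := weight_eq_filter_add F q (fun _ => 1)
  have h2 := weight_filter_mem hF (fun _ => 1) hq
  have h3 : link S F (fun _ => 1) q = link S F u q
      + ∑ a ∈ S, ∑ b ∈ S, ind F q a b * d a * u b
      + ∑ a ∈ S, ∑ b ∈ S, ind F q b a * d a * u b + link S F d q := by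
    rw [Finset.sum_comm (f := fun a b => ind F q b a * d a * u b)]
    unfold link
    simp only [← Finset.sum_add_distrib]
    refine Finset.sum_congr rfl fun a _ => Finset.sum_congr rfl fun b _ => ?_
    linear_combination (-ind F q a b) * (hud b) - ind F q a b * (u b + d b) * hud a
  have h4 : ∑ a ∈ S, ∑ b ∈ S, ind F q b a * d a * u b
      = ∑ a ∈ S, ∑ b ∈ S, ind F q a b * d a * u b :=
    Finset.sum_congr rfl fun a _ => Finset.sum_congr rfl fun b _ => by rw [ind_swap']
  simp only [weight_one] at h1 h2
  rw [h4] at h3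
  linarith

/-- Ordered triples are sorted by the slot that q occupies, if any. -/
theorem sum_mul_link_split (hF : F ⊆ S.powersetCard 3) {q : ℕ} (hq : q ∈ S) (u d : ℕ → ℝ) :
    ∑ a ∈ S, d a * link S F u a = d q * link S F u q
      + 2 * u q * ∑ a ∈ S, ∑ b ∈ S, ind F q a b * d a * u b
      + form S (F.filter (q ∉ ·)) d u u := by
  have h1 : ∑ a ∈ S, d a * link S F u a = form S F d u u := by
    unfold form link
    simp only [Finset.mul_sum]
    exact Finset.sum_congr rfl fun i _ => Finset.sum_congr rfl fun j _ =>
      Finset.sum_congr rfl fun l _ => by ring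
  have h2 : form S F d u u = ∑ i ∈ S, ∑ j ∈ S, ∑ l ∈ S, (if i = q then
      ind F i j l * d i * u j * u l else 0)
      + ∑ i ∈ S, ∑ j ∈ S, ∑ l ∈ S, (if j = q then ind F i j l * d i * u j * u l else 0)
      + ∑ i ∈ S, ∑ j ∈ S, ∑ l ∈ S, (if l = q then ind F i j l * d i * u j * u l else 0)
      + form S (F.filter (q ∉ ·)) d u u := by
    unfold form
    simp only [← Finset.sum_add_distrib]
    refine Finset.sum_congr rfl fun i _ => Finset.sum_congr rfl fun j _ =>
      Finset.sum_congr rfl fun l _ => ?_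
    by_cases h : ({i, j, l} : Finset ℕ) ∈ F
    · obtain ⟨a, b, c⟩ := ne_of_mem hF h
      by_cases hi : i = q
      · subst hi; simp [ind, a.symm, b.symm]
      by_cases hj : j = q
      · subst hj; simp [ind, a, c.symm]
      by_cases hl : l = q
      · subst hl; simp [ind, b, c]
      simp [ind, h, hi, hj, hl, Ne.symm hi, Ne.symm hj, Ne.symm hl]
    · simp [ind, h]
  have h3 : ∑ i ∈ S, ∑ j ∈ S, ∑ l ∈ S, (if i = q then ind F i j l * d i * u j * u l else 0)
      = d q * link S F u q := by
    rw [Finset.sum_eq_single_of_mem q hq fun i _ hi => by simp [hi]]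
    unfold link
    simp only [Finset.mul_sum, if_true]
    exact Finset.sum_congr rfl fun j _ => Finset.sum_congr rfl fun l _ => by ring
  have h4 : ∑ i ∈ S, ∑ j ∈ S, ∑ l ∈ S, (if j = q then ind F i j l * d i * u j * u l else 0)
      = u q * ∑ a ∈ S, ∑ b ∈ S, ind F q a b * d a * u b := by
    rw [Finset.mul_sum]
    refine Finset.sum_congr rfl fun i _ => ?_
    rw [Finset.sum_eq_single_of_mem q hq fun j _ hj => by simp [hj], Finset.mul_sum]
    exact Finset.sum_congr rfl fun l _ => by rw [if_pos rfl, ind_swap]; ring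
  have h5 : ∑ i ∈ S, ∑ j ∈ S, ∑ l ∈ S, (if l = q then ind F i j l * d i * u j * u l else 0)
      = u q * ∑ a ∈ S, ∑ b ∈ S, ind F q a b * d a * u b := by
    rw [Finset.mul_sum]
    refine Finset.sum_congr rfl fun i _ => ?_
    rw [Finset.mul_sum]
    refine Finset.sum_congr rfl fun j _ => ?_
    rw [Finset.sum_eq_single_of_mem q hq fun l _ hl => by simp [hl], if_pos rfl, ind_swap',
      ind_swap]
    ring
  rw [h1, h2, h3, h4, h5]
  ring

/-- For e ≥ 9/20, lowering u, v, w to e one at a time does not increase the right side, and 3e² - e³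
≥ e holds from e = (3 - √5)/2 ≈ 0.382 on. For smaller e the bounds 1/2 already give uw + vw ≥ 1/2.
-/
theorem pairs_sub_triple_ge {e u v w : ℝ} (he : 0 ≤ e) (hu : e ≤ u) (hv : e ≤ v) (hw : e ≤ w)
    (hw1 : w ≤ 1)
    (h : e < 9 / 20 → 1 / 2 ≤ u ∧ 1 / 2 ≤ v ∧ 1 / 2 ≤ w) :
    e ≤ u * v + u * w + v * w - u * v * w := by
  by_cases hc : e < 9 / 20
  · obtain ⟨h1, h2, h3⟩ := h hc
    nlinarith [mul_nonneg (mul_nonneg (he.trans hu) (he.trans hv)) (sub_nonneg.2 hw1)]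
  · have hc := not_lt.1 hc
    have hu0 := he.trans hu
    have hv0 := he.trans hv
    have hw0 := he.trans hw
    have a1 : 0 ≤ (u - e) * (v + w - v * w) := mul_nonneg (by linarith) (by nlinarith)
    have a2 : 0 ≤ (v - e) * (e + w - e * w) := mul_nonneg (by linarith) (by nlinarith)
    have a3 : 0 ≤ (w - e) * (e + e - e * e) := mul_nonneg (by linarith) (by nlinarith)
    have a4 : 0 ≤ e * (3 * e - 1 - e ^ 2) := mul_nonneg he (by nlinarith)
    linarith

/-- The inequality between the triples avoiding `q`, summed. -/
theorem mul_card_le (hF : F ⊆ S.powersetCard 3) {q : ℕ} {u d : ℕ → ℝ} {e : ℝ}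
    (hud : ∀ i, u i + d i = 1) (he : 0 ≤ e) (hu : ∀ i ∈ S, e ≤ u i) (hd : ∀ i ∈ S, 0 ≤ d i)
    (h : e < 9 / 20 → ∀ i ∈ S, i ≠ q → 1 / 2 ≤ u i) :
    e * (F.filter (q ∉ ·)).card
      ≤ 2 * weight (F.filter (q ∉ ·)) u + form S (F.filter (q ∉ ·)) d u u / 2 := by
  set F' := F.filter (q ∉ ·) with hF'def
  have hF' : F' ⊆ S.powersetCard 3 := (filter_subset _ _).trans hF
  have h1 := form_self hF' u
  have h2 := form_self hF' (fun _ => 1)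
  rw [weight_one] at h2
  -- With d = 1 - u, an ordered triple contributes uv + uw + vw - uvw on the right.
  have h3 : e * form S F' (fun _ => 1) (fun _ => 1) (fun _ => 1)
      ≤ 2 * form S F' u u u + form S F' d u u + form S F' u d u + form S F' u u d := by
    unfold form
    simp only [Finset.mul_sum, ← Finset.sum_add_distrib]
    refine Finset.sum_le_sum fun i hi => Finset.sum_le_sum fun j hj =>
      Finset.sum_le_sum fun l hl => ?_
    by_cases hA : ({i, j, l} : Finset ℕ) ∈ F'
    · have hqA := (mem_filter.1 hA).2
      simp only [mem_insert, mem_singleton, not_or] at hqA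
      have hiq := Ne.symm hqA.1
      have hjq := Ne.symm hqA.2.1
      have hlq := Ne.symm hqA.2.2
      have h4 := pairs_sub_triple_ge he (hu i hi) (hu j hj) (hu l hl)
        (by linarith [hud l, hd l hl])
        (fun hc => ⟨h hc i hi hiq, h hc j hj hjq, h hc l hl hlq⟩)
      have hi' : d i = 1 - u i := by linarith [hud i]
      have hj' : d j = 1 - u j := by linarith [hud j]
      have hl' : d l = 1 - u l := by linarith [hud l]
      rw [ind, if_pos hA, hi', hj', hl']
      linarith
    · rw [ind, if_neg hA]; simp
  rw [form_swap' u u d, form_swap u d u, h1, h2] at h3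
  linarith

section Defect

variable {n : ℕ} {d : ℕ → ℝ} {q : ℕ}

/-- The deviations `d` of the weights from the largest one, relative to the latter, together with
the missing triples `F`, for an optimal weighting on `n + 1` vertices. -/
structure IsDefect (S : Finset ℕ) (F : Finset (Finset ℕ)) (n : ℕ) (d : ℕ → ℝ) (q : ℕ) : Prop where
  large : 20000 ≤ n
  sub : F ⊆ S.powersetCard 3
  card_eq : S.card = n + 1
  nonneg : ∀ i ∈ S, 0 ≤ d i
  lt_one : ∀ i ∈ S, d i < 1
  link_eq : ∀ i ∈ S, link S F (fun j => 1 - d j) i = 2 * d i * (n - 1 - ∑ j ∈ S, d j + d i)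
  sum_le : 2 * ∑ i ∈ S, d i + ∑ i ∈ S, d i ^ 2 ≤ 3 + 64 / n
  mem : q ∈ S
  le : ∀ i ∈ S, d i ≤ d q

namespace IsDefect

theorem le_four (h : IsDefect S F n d q) : 0 ≤ ∑ i ∈ S, d i ∧ ∑ i ∈ S, d i ≤ 2 ∧
    0 ≤ ∑ i ∈ S, d i ^ 2 ∧ ∑ i ∈ S, d i ^ 2 ≤ 4 := by
  have hn : (20000 : ℝ) ≤ n := by exact_mod_cast h.large
  have h1 : 64 / (n : ℝ) ≤ 1 := by rw [div_le_one (by linarith)]; linarith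
  have h2 := h.sum_le
  have h3 : 0 ≤ ∑ i ∈ S, d i := Finset.sum_nonneg h.nonneg
  have h4 : 0 ≤ ∑ i ∈ S, d i ^ 2 := Finset.sum_nonneg fun i _ => sq_nonneg _
  exact ⟨h3, by linarith, h4, by linarith⟩

theorem sum_erase_sq (h : IsDefect S F n d q) :
    ∑ i ∈ S, d i ^ 2 = d q ^ 2 + ∑ i ∈ S.erase q, d i ^ 2 :=
  (Finset.add_sum_erase S (fun i => d i ^ 2) h.mem).symm

/-- Sum the link equations against 1 - d and remove the triples through q. The term linear in d is
eliminated by `sum_le`, which is where the large Lagrangian enters. -/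
theorem weight_le (h : IsDefect S F n d q) :
    weight (F.filter (q ∉ ·)) (fun j => 1 - d j)
      ≤ (n - 1 - ∑ i ∈ S, d i) * ((1 - d q) ^ 2 - ∑ i ∈ S.erase q, d i ^ 2) / 2 + 13 := by
  have hn : (20000 : ℝ) ≤ n := by exact_mod_cast h.large
  obtain ⟨h1, h2, h3, h4⟩ := h.le_four
  have h5 := h.sum_erase_sq
  have h6 := sum_mul_link h.sub (fun j => 1 - d j)
  have h7 := weight_eq_filter_add F q (fun j => 1 - d j)
  have h8 := weight_filter_mem h.sub (fun j => 1 - d j) h.mem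
  rw [h.link_eq q h.mem] at h8
  rw [Finset.sum_congr rfl fun i hi => by rw [h.link_eq i hi]] at h6
  have hs := h.sum_le
  set D := ∑ i ∈ S, d i with hD
  set Q := ∑ i ∈ S, d i ^ 2 with hQ
  set Q' := ∑ i ∈ S.erase q, d i ^ 2 with hQ'
  set M : ℝ := n - 1 - D with hM
  have h9 : ∑ i ∈ S, (1 - d i) * (2 * d i * (M + d i))
      = 2 * (M * (D - Q) + Q - ∑ i ∈ S, d i ^ 3) := by
    have : ∀ i, (1 - d i) * (2 * d i * (M + d i))
        = 2 * (M * d i - M * d i ^ 2 + d i ^ 2 - d i ^ 3) := fun i => by ring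
    simp_rw [this]
    rw [← Finset.mul_sum, Finset.sum_sub_distrib, Finset.sum_add_distrib, Finset.sum_sub_distrib,
      ← Finset.mul_sum, ← Finset.mul_sum]
    ring
  have h10 : 0 ≤ ∑ i ∈ S, d i ^ 3 := Finset.sum_nonneg fun i hi => pow_nonneg (h.nonneg i hi) 3
  have h11 := h.nonneg q h.mem
  have h12 := h.lt_one q h.mem
  have h13 : 0 ≤ (1 - d q) * d q ^ 2 := mul_nonneg (by linarith) (sq_nonneg _)
  have hM0 : 0 ≤ M := by linarith
  have h14 : M * (64 / n) ≤ 64 := by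
    rw [mul_div_assoc', div_le_iff₀ (by linarith)]; nlinarith
  have h15 : M * D ≤ M * ((3 + 64 / n - Q) / 2) := mul_le_mul_of_nonneg_left (by linarith) hM0
  rw [h9] at h6
  have h16 : weight (F.filter (q ∉ ·)) (fun j => 1 - d j)
      ≤ M * (1 / 2 - Q / 2 - (1 - d q) * d q) + 13 := by linarith
  rw [h5] at h16
  linarith

/-- This is the sum of the link equations of the vertices other than q, weighted by d. -/
theorem cross_le (h : IsDefect S F n d q) :
    (1 - d q) * ∑ a ∈ S, ∑ b ∈ S, ind F q a b * d a * (1 - d b)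
        + form S (F.filter (q ∉ ·)) d (fun j => 1 - d j) (fun j => 1 - d j) / 2
      ≤ (n - 1 - ∑ i ∈ S, d i) * (∑ i ∈ S.erase q, d i ^ 2) + 4 := by
  obtain ⟨h1, h2, h3, h4⟩ := h.le_four
  have h5 := h.sum_erase_sq
  have h6 := sum_mul_link_split h.sub h.mem (fun j => 1 - d j) d
  rw [← Finset.add_sum_erase S _ h.mem] at h6
  rw [Finset.sum_congr rfl fun i hi => by rw [h.link_eq i (mem_of_mem_erase hi)]] at h6
  set M : ℝ := n - 1 - ∑ i ∈ S, d i with hM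
  have h7 : ∑ i ∈ S.erase q, d i * (2 * d i * (M + d i))
      ≤ ∑ i ∈ S.erase q, (2 * (M + 1)) * d i ^ 2 := by
    refine Finset.sum_le_sum fun i hi => ?_
    have := h.lt_one i (mem_of_mem_erase hi)
    have := mul_nonneg (sq_nonneg (d i)) (by linarith : 0 ≤ 1 - d i)
    linarith
  rw [← Finset.mul_sum] at h7
  have h8 := sq_nonneg (d q)
  linarith

theorem sq_le_erase {i : ℕ} (hi : i ∈ S) (hiq : i ≠ q) : d i ^ 2 ≤ ∑ i ∈ S.erase q, d i ^ 2 :=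
  Finset.single_le_sum (f := fun i => d i ^ 2) (fun _ _ => sq_nonneg _) (mem_erase.2 ⟨hiq, hi⟩)

theorem link_self_le (h : IsDefect S F n d q) : link S F d q ≤ 4 := by
  obtain ⟨h1, h2, -, -⟩ := h.le_four
  have : link S F d q ≤ (∑ i ∈ S, d i) ^ 2 := by
    rw [sq, Finset.sum_mul_sum]
    refine Finset.sum_le_sum fun a ha => Finset.sum_le_sum fun b hb => ?_
    have := mul_le_of_le_one_left (mul_nonneg (h.nonneg a ha) (h.nonneg b hb)) (ind_le_one F q a b)
    linarith
  nlinarith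

/-- The sum of d² over the vertices other than q enters `weight_le` and `cross_le` with opposite
signs and cancels in their combination. -/
theorem card_le_of_eps (h : IsDefect S F n d q) :
    (F.card : ℝ) ≤ n + 2 + 30 / (1 - d q) := by
  have hn : (20000 : ℝ) ≤ n := by exact_mod_cast h.large
  obtain ⟨h1, h2, h3, h4⟩ := h.le_four
  have hw := h.weight_le
  have hc := h.cross_le
  have hl := h.link_self_le
  have hcard := card_eq_of_add_eq_one h.sub h.mem (u := fun j => 1 - d j) (d := d)
    (fun i => by ring)
  rw [h.link_eq q h.mem] at hcard
  have hq0 := h.nonneg q h.mem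
  have hq1 := h.lt_one q h.mem
  have hweight : 0 ≤ weight (F.filter (q ∉ ·)) (fun j => 1 - d j) :=
    Finset.sum_nonneg fun A hA => Finset.prod_nonneg fun i hi => by
      have := h.lt_one i ((mem_powersetCard.1 (h.sub (mem_filter.1 hA).1)).1 hi)
      linarith
  have hmc := mul_card_le h.sub (q := q) (u := fun j => 1 - d j) (d := d) (e := 1 - d q)
    (fun i => by ring) (by linarith) (fun i hi => by linarith [h.le i hi]) h.nonneg (by
      -- When ε < 9/20, nonnegativity of the weight in `weight_le` gives Q' ≤ ε² + 1/500, hence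
      -- every other d is at most 1/2.
      intro he i hi hiq
      have h5 := sq_le_erase (d := d) hi hiq
      have h6 := h.nonneg i hi
      set Q' := ∑ i ∈ S.erase q, d i ^ 2
      set M : ℝ := n - 1 - ∑ i ∈ S, d i
      have hM : 19000 ≤ M := by simp only [M]; linarith
      have h7 : M * (Q' - (1 - d q) ^ 2) ≤ 26 := by linarith
      have h8 : Q' - (1 - d q) ^ 2 ≤ 1 / 500 := by
        by_contra! h9
        nlinarith
      have h9 : (1 - d q) ^ 2 ≤ (9 / 20) ^ 2 := pow_le_pow_left₀ (by linarith) he.le 2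
      have : d i ≤ 1 / 2 := by nlinarith
      linarith)
  set X := ∑ a ∈ S, ∑ b ∈ S, ind F q a b * d a * (1 - d b)
  set Q' := ∑ i ∈ S.erase q, d i ^ 2
  set D := ∑ i ∈ S, d i
  set M : ℝ := n - 1 - D with hM
  set k : ℝ := ((F.filter (q ∉ ·)).card : ℝ)
  set ε := 1 - d q with hε
  have hε0 : 0 < ε := by linarith
  have h6 : ε * (X + k) ≤ ε * (M * ε + 30 / ε) := by
    have : ε * (M * ε + 30 / ε) = M * ε ^ 2 + 30 := by field_simp
    rw [this]
    linarith
  have h7 := le_of_mul_le_mul_left h6 hε0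
  have h8 : d q * (M + d q) + M * ε ≤ n := by
    have : d q = 1 - ε := by rw [hε]; ring
    rw [this]
    nlinarith
  linarith

/-- With g a the weighted degree of a in the link of q, the cross sum is Σ d_a g_a. Cauchy–Schwarz
applies: Σ d_a² is O(1/n) away from q, and Σ g_a² = O(n²) because g ≤ 2n and Σ g_a ≤ 4n. -/
theorem cross_le_sqrt (h : IsDefect S F n d q) (hlink : link S F (fun j => 1 - d j) q ≤ 2 * n)
    (hhalf : ∀ i ∈ S, i ≠ q → 1 / 2 ≤ 1 - d i) (hnQ : n * ∑ i ∈ S.erase q, d i ^ 2 ≤ 30) :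
    ∑ a ∈ S, ∑ b ∈ S, ind F q a b * d a * (1 - d b) ≤ 40 * √n := by
  have hn : (20000 : ℝ) ≤ n := by exact_mod_cast h.large
  set w := √(n : ℝ) with hw'
  have hw0 : 0 < w := Real.sqrt_pos.2 (by linarith)
  have hww : w * w = n := Real.mul_self_sqrt (by linarith)
  set g : ℕ → ℝ := fun a => ∑ b ∈ S, ind F q a b * (1 - d b) with hg
  have hgX : ∑ a ∈ S, ∑ b ∈ S, ind F q a b * d a * (1 - d b) = ∑ a ∈ S, d a * g a := by
    refine Finset.sum_congr rfl fun a _ => ?_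
    rw [hg, Finset.mul_sum]
    exact Finset.sum_congr rfl fun b _ => by ring
  have hg0 : ∀ a ∈ S, 0 ≤ g a := fun a _ => Finset.sum_nonneg fun b hb =>
    mul_nonneg (ind_nonneg _ _ _ _) (by linarith [h.lt_one b hb])
  have hgq : g q = 0 := Finset.sum_eq_zero fun b _ => by rw [ind_self h.sub, zero_mul]
  have hgle : ∀ a ∈ S, g a ≤ 2 * n := by
    intro a _
    have : g a ≤ ∑ b ∈ S, (1 : ℝ) := Finset.sum_le_sum fun b hb =>
      mul_le_one₀ (ind_le_one _ _ _ _) (by linarith [h.lt_one b hb])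
        (by linarith [h.nonneg b hb])
    rw [Finset.sum_const, h.card_eq, nsmul_eq_mul, mul_one] at this
    push_cast at this
    linarith
  have hgsum : ∑ a ∈ S, g a ≤ 4 * n := by
    have : ∑ a ∈ S, g a ≤ 2 * link S F (fun j => 1 - d j) q := by
      unfold link
      rw [Finset.mul_sum]
      refine Finset.sum_le_sum fun a ha => ?_
      have e : ∑ l ∈ S, ind F q a l * (1 - d a) * (1 - d l) = (1 - d a) * g a := by
        rw [hg, Finset.mul_sum]
        exact Finset.sum_congr rfl fun l _ => by ring
      rw [e]
      by_cases haq : a = q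
      · rw [haq, hgq]; simp
      · have := mul_le_mul_of_nonneg_right (hhalf a ha haq) (hg0 a ha)
        linarith
    linarith
  -- AM–GM in the form 2(nw d)(g) ≤ (nw d)² + g² with w = √n, which makes both sums of order n².
  have hgd : (∑ a ∈ S, ∑ b ∈ S, ind F q a b * d a * (1 - d b)) * (2 * n * w) ≤ n ^ 2 * w ^ 2 * (∑ i ∈ S.erase q, d i ^ 2) + ∑ a ∈ S, g a ^ 2 := by
    rw [hgX, ← Finset.add_sum_erase S _ h.mem, hgq, mul_zero, zero_add, Finset.sum_mul,
      Finset.mul_sum, ← Finset.add_sum_erase S (fun a => g a ^ 2) h.mem, hgq, ← add_assoc,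
      add_right_comm, ← Finset.sum_add_distrib]
    have : ∑ i ∈ S.erase q, d i * g i * (2 * n * w)
        ≤ ∑ i ∈ S.erase q, (n ^ 2 * w ^ 2 * d i ^ 2 + g i ^ 2) :=
      Finset.sum_le_sum fun i _ => by nlinarith [sq_nonneg (n * w * d i - g i)]
    linarith
  have hg2 : ∑ a ∈ S, g a ^ 2 ≤ 2 * n * (4 * n) := by
    calc ∑ a ∈ S, g a ^ 2 ≤ ∑ a ∈ S, 2 * n * g a := Finset.sum_le_sum fun a ha => by
          rw [sq]; exact mul_le_mul_of_nonneg_right (hgle a ha) (hg0 a ha)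
      _ = 2 * n * ∑ a ∈ S, g a := by rw [Finset.mul_sum]
      _ ≤ _ := mul_le_mul_of_nonneg_left hgsum (by linarith)
  have h5 : (n : ℝ) ^ 2 * w ^ 2 * (∑ i ∈ S.erase q, d i ^ 2) ≤ 30 * n ^ 2 := by
    have : (n : ℝ) ^ 2 * w ^ 2 * (∑ i ∈ S.erase q, d i ^ 2)
        = n ^ 2 * (n * ∑ i ∈ S.erase q, d i ^ 2) := by rw [← hww]; ring
    rw [this, mul_comm 30]
    exact mul_le_mul_of_nonneg_left hnQ (sq_nonneg _)
  have h6 : (∑ a ∈ S, ∑ b ∈ S, ind F q a b * d a * (1 - d b)) * (2 * n * w)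
      ≤ 40 * w * (2 * n * w) := by
    have : 40 * w * (2 * n * w) = 80 * (n : ℝ) ^ 2 := by
      rw [show 40 * w * (2 * n * w) = 80 * n * (w * w) by ring, hww]; ring
    rw [this]
    linarith [sq_nonneg (n : ℝ)]
  exact le_of_mul_le_mul_right h6 (by positivity)

/-- For tiny ε, `weight_le` leaves only a bounded weight for the triples avoiding q. Each weighs at
least 1/8, so there are boundedly many, and the cross sum is the only term of order √n. -/
theorem card_le_of_lt (h : IsDefect S F n d q) (hε : (1 - d q) ^ 2 * n ≤ 1) :
    (F.card : ℝ) ≤ n + 120 + 40 * √n := by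
  have hn : (20000 : ℝ) ≤ n := by exact_mod_cast h.large
  obtain ⟨h1, h2, h3, h4⟩ := h.le_four
  have hw := h.weight_le
  have hl := h.link_self_le
  have hcard := card_eq_of_add_eq_one h.sub h.mem (u := fun j => 1 - d j) (d := d)
    (fun i => by ring)
  have hlq := h.link_eq q h.mem
  have hq0 := h.nonneg q h.mem
  have hq1 := h.lt_one q h.mem
  have hweight : 0 ≤ weight (F.filter (q ∉ ·)) (fun j => 1 - d j) :=
    Finset.sum_nonneg fun A hA => Finset.prod_nonneg fun i hi => by
      have := h.lt_one i ((mem_powersetCard.1 (h.sub (mem_filter.1 hA).1)).1 hi)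
      linarith
  have hQ'0 : 0 ≤ ∑ i ∈ S.erase q, d i ^ 2 := Finset.sum_nonneg fun i _ => sq_nonneg _
  have hsq := fun i (hi : i ∈ S) (hiq : i ≠ q) => sq_le_erase (d := d) hi hiq
  set X := ∑ a ∈ S, ∑ b ∈ S, ind F q a b * d a * (1 - d b) with hX
  set Q' := ∑ i ∈ S.erase q, d i ^ 2 with hQ'
  set D := ∑ i ∈ S, d i
  set M : ℝ := n - 1 - D with hM
  have hM1 : 9 / 10 * n ≤ M := by linarith
  have hMn : M ≤ n := by linarith
  have hMε : M * (1 - d q) ^ 2 ≤ 1 := by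
    have := mul_le_mul_of_nonneg_right hMn (sq_nonneg (1 - d q))
    linarith
  have hnQ : n * Q' ≤ 30 := by
    have := mul_le_mul_of_nonneg_right hM1 hQ'0
    linarith
  have hMQ : 0 ≤ M * Q' := mul_nonneg (by linarith) hQ'0
  have hhalf : ∀ i ∈ S, i ≠ q → 1 / 2 ≤ 1 - d i := by
    intro i hi hiq
    have h5 := hsq i hi hiq
    have h6 := h.nonneg i hi
    have : Q' ≤ 1 / 4 := by nlinarith
    nlinarith
  have hk : ((F.filter (q ∉ ·)).card : ℝ) ≤ 112 := by
    have : ((F.filter (q ∉ ·)).card : ℝ) * (1 / 2) ^ 3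
        ≤ weight (F.filter (q ∉ ·)) (fun j => 1 - d j) := by
      rw [← nsmul_eq_mul]
      refine card_nsmul_le_sum _ _ _ fun A hA => ?_
      obtain ⟨hAS, hA3⟩ := mem_powersetCard.1 (h.sub (mem_filter.1 hA).1)
      rw [show ((1 : ℝ) / 2) ^ 3 = ∏ i ∈ A, 1 / 2 by rw [prod_const, hA3]]
      exact prod_le_prod (fun i _ => by positivity) fun i hi =>
        hhalf i (hAS hi) fun e => (mem_filter.1 hA).2 (e ▸ hi)
    linarith
  have hlink : link S F (fun j => 1 - d j) q ≤ 2 * n := by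
    rw [hlq]
    have : d q * (M + d q) ≤ 1 * n :=
      mul_le_mul hq1.le (by linarith) (by linarith) (by linarith)
    linarith
  have hXle : X ≤ 40 * √n := h.cross_le_sqrt hlink hhalf hnQ
  linarith

/-- The number of missing triples exceeds the number of vertices by at most `O(√n)`. -/
theorem card_le (h : IsDefect S F n d q) : (F.card : ℝ) ≤ n + 120 + 40 * √n := by
  -- The split at ε = 1/√n is where 30/ε reaches order √n.
  by_cases hε : (1 - d q) ^ 2 * n ≤ 1
  · exact h.card_le_of_lt hε
  · have h1 := h.card_le_of_eps
    have hq1 := h.lt_one q h.mem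
    have hn : (20000 : ℝ) ≤ n := by exact_mod_cast h.large
    have hw0 : 0 < √(n : ℝ) := Real.sqrt_pos.2 (by linarith)
    have hww : √(n : ℝ) * √(n : ℝ) = n := Real.mul_self_sqrt (by linarith)
    have h2 : 1 ≤ (1 - d q) * √n := by
      by_contra! h3
      refine hε ?_
      rw [← hww]
      have h4 : 0 ≤ (1 - d q) * √n := mul_nonneg (by linarith) hw0.le
      nlinarith
    have h3 : 30 / (1 - d q) ≤ 30 * √n := by
      rw [div_le_iff₀ (by linarith)]
      linarith
    linarith

end IsDefect

end Defect

/-- Here d = 1 - y / y_p, and summing over the n + 1 vertices gives 1 / y_p = n + 1 - Σ d, which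
turns `link_missing` into `link_eq`. -/
theorem IsExtremal.exists_isDefect {m : ℕ} {H : Finset (Finset ℕ)} {y : ℕ → ℝ} {p n : ℕ}
    (h : IsExtremal S m H y p) (hn : 20000 ≤ n) (hS : S.card = n + 1)
    (hr : 1 - 3 * (n : ℝ)⁻¹ + 2 * (n : ℝ)⁻¹ ^ 2 < 6 * weight H y) :
    ∃ d q, IsDefect S (S.powersetCard 3 \ H) n d q := by
  obtain ⟨q, hq, hqmin⟩ := S.exists_min_image y ⟨p, h.mem⟩
  have hn' : (20000 : ℝ) ≤ n := by exact_mod_cast hn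
  set r : ℝ := (n : ℝ)⁻¹ with hrdef
  have hr0 : 0 < r := by positivity
  have hnr : (n : ℝ) * r = 1 := mul_inv_cancel₀ (by positivity)
  have hr1 : r ≤ 1 / 20000 := by nlinarith
  have ha2 := h.lt_two_mul hr0 (by linarith) hr
  have hsix := h.six_weight
  set a := y p with ha
  have ha0 : 0 < a := h.pos p h.mem
  set N := a⁻¹ with hN
  have haN : a * N = 1 := mul_inv_cancel₀ ha0.ne'
  set d : ℕ → ℝ := fun i => 1 - y i * N with hd
  have hud : ∀ i, 1 - d i = y i * N := fun i => by simp only [hd]; ring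
  have hN0 : 0 < N := inv_pos.2 ha0
  have hsumd : ∑ i ∈ S, d i = n + 1 - N := by
    simp only [hd, Finset.sum_sub_distrib, ← Finset.sum_mul, h.sum_eq, Finset.sum_const, hS,
      nsmul_eq_mul]
    push_cast
    ring
  have hd0 : ∀ i ∈ S, 0 ≤ d i := fun i hi => by
    have := mul_le_mul_of_nonneg_right (h.le i hi) hN0.le
    simp only [hd]; linarith
  have hD0 : 0 ≤ ∑ i ∈ S, d i := Finset.sum_nonneg hd0
  have hP : ∑ i ∈ S, y i ^ 2 = a ^ 2 * (N - ∑ i ∈ S, d i + ∑ i ∈ S, d i ^ 2) := by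
    have e : ∀ i, y i ^ 2 = a ^ 2 * (1 - 2 * d i + d i ^ 2) := fun i => by
      have : y i = a * (1 - d i) := by rw [hud]; linear_combination (-y i) * haN
      rw [this]; ring
    simp_rw [e]
    rw [← Finset.mul_sum, Finset.sum_add_distrib, Finset.sum_sub_distrib, ← Finset.mul_sum,
      Finset.sum_const, hS, nsmul_eq_mul, hsumd]
    push_cast
    ring
  have hPge : r - r ^ 2 ≤ ∑ i ∈ S, y i ^ 2 := by
    have h1 := sq_sum_le_card_mul_sum_sq (s := S) (f := y)
    rw [h.sum_eq, hS] at h1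
    push_cast at h1
    have h2 : 0 ≤ ∑ i ∈ S, y i ^ 2 := Finset.sum_nonneg fun i _ => sq_nonneg _
    by_contra! h3
    nlinarith
  have haub : a ≤ r + 4 * r ^ 2 := by nlinarith
  have hNlb : n - 4 ≤ N := by
    by_contra! h1
    have h2 : a * N ≤ (r + 4 * r ^ 2) * (n - 4) :=
      mul_le_mul haub h1.le hN0.le (by positivity)
    nlinarith
  refine ⟨d, q, hn, sdiff_subset, hS, hd0, fun i hi => ?_, fun i hi => ?_, ?_, hq, fun i hi => ?_⟩
  · have := mul_pos (h.pos i hi) hN0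
    simp only [hd]; linarith
  · have e1 : link S (S.powersetCard 3 \ H) (fun j => 1 - d j) i
        = N ^ 2 * link S (S.powersetCard 3 \ H) y i := by
      unfold link
      simp only [Finset.mul_sum, hud]
      exact Finset.sum_congr rfl fun j _ => Finset.sum_congr rfl fun l _ => by ring
    rw [e1, h.link_missing hi, hsumd]
    simp only [hd]
    linear_combination (2 * (N - a * N - 1)) * haN
  · rw [hP] at hsix
    set D := ∑ i ∈ S, d i with hDdef
    set Q := ∑ i ∈ S, d i ^ 2 with hQ
    have hNeq : N = n + 1 - D := by linarith
    have h1 : 2 * a - 2 * a ^ 2 + a ^ 2 * (N - D + Q) < 3 * r - 2 * r ^ 2 := by linarith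
    have h2 : N ^ 2 * (2 * a - 2 * a ^ 2 + a ^ 2 * (N - D + Q)) < N ^ 2 * (3 * r - 2 * r ^ 2) :=
      mul_lt_mul_of_pos_left h1 (by positivity)
    have h3 : N ^ 2 * (2 * a - 2 * a ^ 2 + a ^ 2 * (N - D + Q)) = 3 * N - 2 - D + Q := by
      have : N ^ 2 * (2 * a - 2 * a ^ 2 + a ^ 2 * (N - D + Q))
          = 2 * N * (a * N) - 2 * (a * N) ^ 2 + (a * N) ^ 2 * (N - D + Q) := by ring
      rw [this, haN]; ring
    have hrN : r * N = 1 - r * (D - 1) := by rw [hNeq]; linear_combination hnr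
    have h4 : N ^ 2 * (3 * r - 2 * r ^ 2)
        = 3 * N * (1 - r * (D - 1)) - 2 * (1 - r * (D - 1)) ^ 2 := by
      rw [← hrN]; ring
    have h5 : 3 * N * (1 - r * (D - 1)) = 3 * N - 3 * (D - 1) * (1 - r * (D - 1)) := by
      rw [show 3 * N * (1 - r * (D - 1)) = 3 * N - 3 * (D - 1) * (r * N) by ring, hrN]
    rw [h3, h4, h5] at h2
    -- The constant 64 is the value of 3(D - 1)² + 4(D - 1) at D = 5, and `hNlb` gives D ≤ 5.
    have h6 : r * (3 * (D - 1) ^ 2 + 4 * (D - 1)) ≤ r * 64 :=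
      mul_le_mul_of_nonneg_left
        (by linarith [mul_nonneg hD0 (by linarith : 0 ≤ 5 - D)]) hr0.le
    have h7 : 64 / (n : ℝ) = r * 64 := by rw [hrdef]; ring
    rw [h7]
    linarith [sq_nonneg (r * (D - 1))]
  · have := mul_le_mul_of_nonneg_right (hqmin i hi) hN0.le
    simp only [hd]; linarith


/-! ### Conclusion: the upper bound and its attainment by colex segments -/

/-- A `3`-graph that misses sufficiently many triples on `n + 1` vertices has at most the
Lagrangian of the complete `3`-graph on `n` vertices. -/
theorem isBound_of_le {m n : ℕ} (hn : 20000 ≤ n) (hm : m ≤ (n + 1).choose 3)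
    (hm' : (m : ℝ) + (n + 120 + 40 * √n) < (n + 1).choose 3) (S : Finset ℕ) :
    IsBound S m ((1 - 3 / (n : ℝ) + 2 / (n : ℝ) ^ 2) / 6) := by
  induction hk : S.card using Nat.strong_induction_on generalizing S with
  | _ k ih =>
    by_contra hbad
    have hsmall : ∀ q ∈ S, IsBound (S.erase q) m ((1 - 3 / (n : ℝ) + 2 / (n : ℝ) ^ 2) / 6) :=
      fun q hq => ih _ (hk ▸ card_erase_lt_of_mem hq) _ rfl
    obtain ⟨H, y, p, h, hc⟩ := exists_isExtremal hbad hsmall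
    have hr : 1 - 3 * (n : ℝ)⁻¹ + 2 * (n : ℝ)⁻¹ ^ 2 < 6 * weight H y := by
      have : 1 - 3 / (n : ℝ) + 2 / (n : ℝ) ^ 2 = 1 - 3 * (n : ℝ)⁻¹ + 2 * (n : ℝ)⁻¹ ^ 2 := by
        rw [inv_pow]; ring
      linarith
    rcases lt_trichotomy S.card (n + 1) with h1 | h1 | h1
    · exact hbad (isBound_of_card_le (by omega) (by omega))
    · obtain ⟨d, q, hd⟩ := h.exists_isDefect hn h1 hr
      have h2 := hd.card_le
      have h3 := card_sdiff_add_card_eq_card h.sub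
      rw [card_powersetCard, h1] at h3
      have h4 : ((S.powersetCard 3 \ H).card : ℝ) + H.card = (n + 1).choose 3 := by
        exact_mod_cast h3
      have h5 : (H.card : ℝ) ≤ m := by exact_mod_cast h.card_le
      linarith
    · exact h.false_of_large hn hm hr (by omega) hc hsmall

theorem lagrangian_le_of_isBound {H : Finset (Finset ℕ)} (hH : IsUniform 3 H) {c : ℝ}
    (h : ∀ S, IsBound S H.card c) : lagrangian H ≤ c := by
  obtain ⟨y, hy, hyl⟩ := (isGreatest_lagrangian H).1
  rw [← hyl]
  refine h (y.support ∪ H.biUnion id) H (fun A hA => ?_) le_rfl y (fun i _ => hy.1 i)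
    (sum_eq_of_mem_weightings hy subset_union_left)
  exact mem_powersetCard.2
    ⟨(subset_biUnion_of_mem id hA).trans subset_union_right, hH A hA⟩

/-- If a triple A of the first n vertices were absent, the whole segment would precede A, leaving
room for fewer than C(n,3) members. -/
theorem powersetCard_subset_colexSegment {m n : ℕ} (h : n.choose 3 ≤ m) :
    (range n).powersetCard 3 ⊆ colexSegment m 3 := by
  intro A hA
  by_contra hAm
  obtain ⟨hAn, hA3⟩ := mem_powersetCard.1 hA
  have hinit := isInitSeg_colexSegment m 3
  have hsub : colexSegment m 3 ⊆ ((range n).powersetCard 3).erase A := by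
    intro B hB
    have hB3 : B.card = 3 := hinit.1 hB
    have hBA : B ≠ A := by rintro rfl; exact hAm hB
    have hlt : toColex B < toColex A := by
      rcases lt_trichotomy (toColex A) (toColex B) with h1 | h1 | h1
      · exact absurd (hinit.2 hB ⟨h1, hA3⟩) hAm
      · exact absurd (toColex_inj.1 h1).symm hBA
      · exact h1
    refine mem_erase.2 ⟨hBA, mem_powersetCard.2 ⟨fun b hb => mem_range.2 ?_, hB3⟩⟩
    exact Finset.Colex.forall_lt_mono hlt.le (fun a ha => mem_range.1 (hAn ha)) b hb
  have h1 := card_le_card hsub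
  have h2 := card_erase_lt_of_mem hA
  rw [card_colexSegment m 3 (by norm_num)] at h1
  rw [card_powersetCard, card_range] at h2
  omega

theorem le_lagrangian_colexSegment {m n : ℕ} (hn : 0 < n) (h : n.choose 3 ≤ m) :
    (1 - 3 / (n : ℝ) + 2 / (n : ℝ) ^ 2) / 6 ≤ lagrangian (colexSegment m 3) := by
  have hn' : (0 : ℝ) < n := by exact_mod_cast hn
  let y : ℕ →₀ ℝ := Finsupp.onFinset (range n) (fun i => if i < n then (n : ℝ)⁻¹ else 0)
    (fun i hi => by
      by_contra hc
      exact hi (if_neg (by simpa using hc)))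
  have hy : ∀ i, y i = if i < n then (n : ℝ)⁻¹ else 0 := fun i => rfl
  have hy0 : ∀ i, 0 ≤ y i := fun i => by
    rw [hy]; split_ifs <;> positivity
  have hyn : ∀ i ∈ range n, y i = (n : ℝ)⁻¹ := fun i hi => by
    rw [hy, if_pos (mem_range.1 hi)]
  have hsum : ∑ i ∈ range n, y i = 1 := by
    rw [sum_congr rfl hyn, sum_const, card_range, nsmul_eq_mul, mul_inv_cancel₀ hn'.ne']
  have hmem : y ∈ weightings := by
    refine ⟨hy0, ?_⟩
    rw [← hsum]
    exact sum_subset Finsupp.support_onFinset_subset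
      (fun i _ hi => Finsupp.notMem_support_iff.1 hi)
  refine le_trans ?_ ((isGreatest_lagrangian _).2 ⟨y, hmem, rfl⟩)
  have h1 : weight ((range n).powersetCard 3) y ≤ edgePoly (colexSegment m 3) y :=
    sum_le_sum_of_subset_of_nonneg (powersetCard_subset_colexSegment h) fun A _ _ =>
      prod_nonneg fun i _ => hy0 i
  have h2 := weight_complete (S := range n) y
  have hpow : ∀ k : ℕ, ∑ i ∈ range n, y i ^ k = n * (n : ℝ)⁻¹ ^ k := fun k => by
    rw [sum_congr rfl fun i hi => by rw [hyn i hi], sum_const, card_range, nsmul_eq_mul]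
  rw [hsum, hpow, hpow] at h2
  have h3 : (1 : ℝ) ^ 3 - 3 * 1 * (n * (n : ℝ)⁻¹ ^ 2) + 2 * (n * (n : ℝ)⁻¹ ^ 3)
      = 1 - 3 / (n : ℝ) + 2 / (n : ℝ) ^ 2 := by
    field_simp
  linarith

end HypergraphLagrangian

theorem corollary1p6 :
    ∃ δ : ℝ, 0 < δ ∧ ∀ t m : ℕ, 1 ≤ t → (t - 1).choose 3 ≤ m →
      (m : ℝ) ≤ (t.choose 3 : ℝ) - ((t : ℝ) - 2) - δ * (t : ℝ) ^ (3 / 4 : ℝ) →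
      IsGreatest
        {l : ℝ | ∃ H : Finset (Finset ℕ), HypergraphLagrangian.IsUniform 3 H ∧ H.card = m ∧
          HypergraphLagrangian.lagrangian H = l}
        (HypergraphLagrangian.lagrangian (HypergraphLagrangian.colexSegment m 3)) := by
  -- So large a δ empties the range of m unless n ≥ 20000, since C(n+1,3) - C(n,3) = C(n,2) ≤ n²; it
  -- also absorbs 120 + 40√n.
  refine ⟨10 ^ 9, by norm_num, fun t m ht hm hmt => ?_⟩
  obtain ⟨n, rfl⟩ := Nat.exists_eq_add_of_le' ht
  rw [Nat.add_sub_cancel] at hm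
  have hn0 : (0 : ℝ) ≤ n := Nat.cast_nonneg n
  have ht1 : (1 : ℝ) ≤ ((n + 1 : ℕ) : ℝ) := by push_cast; linarith
  have hpow1 : 1 ≤ ((n + 1 : ℕ) : ℝ) ^ (3 / 4 : ℝ) := Real.one_le_rpow ht1 (by norm_num)
  have hpow2 : √(n : ℝ) ≤ ((n + 1 : ℕ) : ℝ) ^ (3 / 4 : ℝ) := by
    refine (Real.sqrt_le_sqrt (by push_cast; linarith : (n : ℝ) ≤ ((n + 1 : ℕ) : ℝ))).trans ?_
    rw [Real.sqrt_eq_rpow]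
    exact Real.rpow_le_rpow_of_exponent_le ht1 (by norm_num)
  have hm1 : (n.choose 3 : ℝ) ≤ m := by exact_mod_cast hm
  have hch : ((n + 1).choose 3 : ℝ) = n.choose 2 + n.choose 3 := by
    exact_mod_cast Nat.choose_succ_succ n 2
  have hch2 : (n.choose 2 : ℝ) ≤ (n : ℝ) ^ 2 := by
    exact_mod_cast Nat.choose_le_pow n 2
  push_cast at hmt hpow1 hpow2
  have hn : 20000 ≤ n := by
    by_contra! h
    have h' : (n : ℝ) ≤ 20000 := by exact_mod_cast h.le
    nlinarith
  have hm' : (m : ℝ) + (n + 120 + 40 * √(n : ℝ)) < (n + 1).choose 3 := by linarith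
  have hm'' : m ≤ (n + 1).choose 3 := by
    have : (m : ℝ) ≤ (n + 1).choose 3 := by linarith [Real.sqrt_nonneg (n : ℝ)]
    exact_mod_cast this
  refine ⟨⟨_, (HypergraphLagrangian.isInitSeg_colexSegment m 3).1,
    HypergraphLagrangian.card_colexSegment m 3 (by norm_num), rfl⟩, ?_⟩
  rintro _ ⟨H, hH, hcard, rfl⟩
  refine (HypergraphLagrangian.lagrangian_le_of_isBound hH fun S => ?_).trans
    (HypergraphLagrangian.le_lagrangian_colexSegment (by omega) hm)
  rw [hcard]
  exact HypergraphLagrangian.isBound_of_le hn hm'' hm' S
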